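/- Let $\mathbb T=\mathbb R/\mathbb Z$, let $\alpha\in\mathbb R$ be irrational, and let $f:\mathbb T\to\mathbb R$ be continuous, of bounded variation and symmetric, i.e. $\int_{\mathbb T} f(x)\,dx=0$. Put $\mathfrak p(x)=\dfrac{e^{f(x)}}{1+e^{f(x)}}$ and $\mathfrak q(x)=1-\mathfrak p(x)$, and let $\mu_*$ be the (unique) Borel probability measure on $\mathbb T$ that is stationary for the transition kernel $p(x,\cdot)=\mathfrak p(x)\,\delta_{x+\alpha}+\mathfrak q(x)\,\delta_{x-\alpha}$. For $x\in\mathbb T$ let $(\xi_n)_{n\ge 0}$ be, under $\mathbb P_x$, the nearest neighbour random walk on $\mathbb Z$ with $\xi_0=0$ and $$\mathbb P_x(\xi_{n+1}=k+1\mid \xi_n=k)=\mathfrak p(x+k\alpha),\qquad \mathbb P_x(\xi_{n+1}=k-1\mid \xi_n=k)=\mathfrak q(x+k\alpha),$$ and for $a\in\mathbb Z$ let $$\mu_{x,a}=\sum_{n=1}^{\infty}\mathbb P_x(\xi_1\neq 0,\dots,\xi_{n-1}\neq 0,\ \xi_n=a).$$ For $q\ge 2$ define the probability measures $$\nu^{\mathrm{odd}}_{x,q}=\frac{1}{M^{\mathrm{odd}}_{x,q}}\sum_{\substack{0\le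 k<q\\ k\ \mathrm{odd}}}\mu_{x,k}\,\delta_{x+k\alpha},\qquad \nu^{\mathrm{even}}_{x,q}=\frac{1}{M^{\mathrm{even}}_{x,q}}\sum_{\substack{0\le k<q\\ k\ \mathrm{even}}}\mu_{x,k}\,\delta_{x+k\alpha},$$ where $M^{\mathrm{odd}}_{x,q}$ and $M^{\mathrm{even}}_{x,q}$ are the normalizing constants. A positive integer $q$ is called a close return time of $\alpha$ if $|\alpha-p/q|<1/q^2$ for some $p\in\mathbb Z$. Then for every continuous $\varphi:\mathbb T\to\mathbb R$ and every $\varepsilon>0$ there exists $q_0$ such that $$\sup_{x\in\mathbb T}\left|\int_{\mathbb T}\varphi\,d\nu^{\mathrm{odd}}_{x,q}-\int_{\mathbb T}\varphi\,d\mu_*\right|<\varepsilon\qquad\text{and}\qquad \sup_{x\in\mathbb T}\left|\int_{\mathbb T}\varphi\,d\nu^{\mathrm{even}}_{x,q}-\int_{\mathbb T}\varphi\,d\mu_*\right|<\varepsilon$$ for every close return time $q$ of $\alpha$ with $q\ge q_0$. -/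

import Mathlib

open MeasureTheory ProbabilityTheory
open scoped ENNReal

namespace QuasiPeriodicWalk

noncomputable section

/-- The probability `p(x) = exp f(x) / (1 + exp f(x))` of a jump by `+α` from `x`. -/
def jumpRight (f : C(UnitAddCircle, ℝ)) (x : UnitAddCircle) : ℝ :=
  Real.exp (f x) / (1 + Real.exp (f x))

/-- The probability `q(x) = 1 - p(x)` of a jump by `-α` from `x`. -/
def jumpLeft (f : C(UnitAddCircle, ℝ)) (x : UnitAddCircle) : ℝ :=
  1 - jumpRight f x

/-- `f` is symmetric: `∫ f = 0` for the Haar probability measure of the circle, where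
`f = log (p / q)`. -/
def IsSymmetric (f : C(UnitAddCircle, ℝ)) : Prop :=
  ∫ x : UnitAddCircle, f x = 0

/-- `f` has bounded variation on the circle: its lift to `ℝ` has bounded variation on `[0, 1]`. -/
def HasBoundedVariation (f : C(UnitAddCircle, ℝ)) : Prop :=
  BoundedVariationOn (fun t : ℝ => f (t : UnitAddCircle)) (Set.Icc 0 1)

theorem jumpRight_nonneg (f : C(UnitAddCircle, ℝ)) (x : UnitAddCircle) :
    0 ≤ jumpRight f x := by
  unfold jumpRight
  positivity

theorem jumpLeft_nonneg (f : C(UnitAddCircle, ℝ)) (x : UnitAddCircle) :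
    0 ≤ jumpLeft f x := by
  unfold jumpLeft jumpRight
  rw [sub_nonneg, div_le_one (by positivity)]
  linarith [Real.exp_pos (f x)]

theorem ofReal_jump_add (f : C(UnitAddCircle, ℝ)) (x : UnitAddCircle) :
    ENNReal.ofReal (jumpRight f x) + ENNReal.ofReal (jumpLeft f x) = 1 := by
  rw [← ENNReal.ofReal_add (jumpRight_nonneg f x) (jumpLeft_nonneg f x)]
  simp [jumpLeft]

theorem measurable_jumpRight (f : C(UnitAddCircle, ℝ)) : Measurable (jumpRight f) := by
  have hf : Measurable f := f.continuous.measurable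
  unfold jumpRight
  fun_prop

theorem measurable_jumpLeft (f : C(UnitAddCircle, ℝ)) : Measurable (jumpLeft f) :=
  measurable_const.sub (measurable_jumpRight f)

/-- The transition kernel `p(x) δ_{x+α} + q(x) δ_{x-α}` on the circle. -/
def circleKernel (f : C(UnitAddCircle, ℝ)) (α : ℝ) : Kernel UnitAddCircle UnitAddCircle where
  toFun x :=
    ENNReal.ofReal (jumpRight f x) • Measure.dirac (x + (α : UnitAddCircle)) +
      ENNReal.ofReal (jumpLeft f x) • Measure.dirac (x - (α : UnitAddCircle))
  measurable' := by
    refine Measure.measurable_of_measurable_coe _ fun s hs => ?_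
    simp only [Measure.coe_add, Measure.coe_smul, Pi.add_apply, Pi.smul_apply, smul_eq_mul,
      Measure.dirac_apply' _ hs]
    have h1 : Measurable fun x : UnitAddCircle =>
        s.indicator (1 : UnitAddCircle → ℝ≥0∞) (x + (α : UnitAddCircle)) :=
      (measurable_one.indicator hs).comp (continuous_add_const _).measurable
    have h2 : Measurable fun x : UnitAddCircle =>
        s.indicator (1 : UnitAddCircle → ℝ≥0∞) (x - (α : UnitAddCircle)) :=
      (measurable_one.indicator hs).comp (continuous_sub_right _).measurable
    exact ((measurable_jumpRight f).ennreal_ofReal.mul h1).add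
      ((measurable_jumpLeft f).ennreal_ofReal.mul h2)

/-- `μ` is a stationary distribution of the transition kernel on the circle. -/
def IsStationary (f : C(UnitAddCircle, ℝ)) (α : ℝ) (μ : Measure UnitAddCircle) : Prop :=
  IsProbabilityMeasure μ ∧ Kernel.Invariant (circleKernel f α) μ

/-- The point `x + k α` of the circle. -/
def orbitPoint (α : ℝ) (x : UnitAddCircle) (k : ℤ) : UnitAddCircle :=
  x + k • (α : UnitAddCircle)

/-- The transition kernel of the nearest neighbour walk on `ℤ` in the environment
`p_k = p(x + k α)`, `q_k = q(x + k α)`. -/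
def walkKernel (f : C(UnitAddCircle, ℝ)) (α : ℝ) (x : UnitAddCircle) : Kernel ℤ ℤ where
  toFun k :=
    ENNReal.ofReal (jumpRight f (orbitPoint α x k)) • Measure.dirac (k + 1) +
      ENNReal.ofReal (jumpLeft f (orbitPoint α x k)) • Measure.dirac (k - 1)
  measurable' := measurable_of_countable _

instance (f : C(UnitAddCircle, ℝ)) (α : ℝ) (x : UnitAddCircle) :
    IsMarkovKernel (walkKernel f α x) where
  isProbabilityMeasure k := ⟨by
    simpa [walkKernel] using ofReal_jump_add f (orbitPoint α x k)⟩

/-- The same kernel, as a function of the whole path up to time `n` that looks only at the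
position at time `n`. -/
def historyKernel (f : C(UnitAddCircle, ℝ)) (α : ℝ) (x : UnitAddCircle) (n : ℕ) :
    Kernel ((_ : Finset.Iic n) → ℤ) ℤ :=
  (walkKernel f α x).comap (fun ω => ω ⟨n, Finset.mem_Iic.2 le_rfl⟩) (measurable_pi_apply _)

instance (f : C(UnitAddCircle, ℝ)) (α : ℝ) (x : UnitAddCircle) (n : ℕ) :
    IsMarkovKernel (historyKernel f α x n) := by
  unfold historyKernel
  infer_instance

/-- The law `P_x` on `ℕ → ℤ` of the walk `(ξ_n)` started at `ξ_0 = 0`; here `ξ_n` is the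
`n`-th coordinate. -/
def walkLaw (f : C(UnitAddCircle, ℝ)) (α : ℝ) (x : UnitAddCircle) : Measure (ℕ → ℤ) :=
  Kernel.trajMeasure (X := fun _ => ℤ) (Measure.dirac 0) (historyKernel f α x)

/-- `μ_{x,a} = ∑_{n ≥ 1} P_x(ξ_1 ≠ 0, …, ξ_{n-1} ≠ 0, ξ_n = a)`; the summation index is `n - 1`. -/
def excursionWeight (f : C(UnitAddCircle, ℝ)) (α : ℝ) (x : UnitAddCircle) (a : ℤ) : ℝ≥0∞ :=
  ∑' n : ℕ, walkLaw f α x {ω | (∀ i : ℕ, 1 ≤ i → i < n + 1 → ω i ≠ 0) ∧ ω (n + 1) = a}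

/-- The normalization of `∑_{k ∈ s} μ_{x,k} δ_{x + k α}`, for a finite set `s` of sites. -/
def excursionMeasure (f : C(UnitAddCircle, ℝ)) (α : ℝ) (x : UnitAddCircle) (s : Finset ℕ) :
    Measure UnitAddCircle :=
  (∑ k ∈ s, excursionWeight f α x (k : ℤ))⁻¹ •
    ∑ k ∈ s, excursionWeight f α x (k : ℤ) • Measure.dirac (orbitPoint α x (k : ℤ))

/-- `ν_{x,q}^{odd}`: the sum is over odd `0 ≤ k < q`. -/
def oddMeasure (f : C(UnitAddCircle, ℝ)) (α : ℝ) (x : UnitAddCircle) (q : ℕ) :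
    Measure UnitAddCircle :=
  excursionMeasure f α x {k ∈ Finset.range q | Odd k}

/-- `ν_{x,q}^{even}`: the sum is over even `0 ≤ k < q`. -/
def evenMeasure (f : C(UnitAddCircle, ℝ)) (α : ℝ) (x : UnitAddCircle) (q : ℕ) :
    Measure UnitAddCircle :=
  excursionMeasure f α x {k ∈ Finset.range q | Even k}

/-- `q ≥ 1` is a close return time of `α`: `|α - p/q| < 1/q²` for some integer `p`. -/
def IsCloseReturnTime (α : ℝ) (q : ℕ) : Prop :=
  q ≠ 0 ∧ ∃ p : ℤ, |α - (p : ℝ) / (q : ℝ)| < 1 / (q : ℝ) ^ 2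

end

end QuasiPeriodicWalk

namespace QuasiPeriodicWalk

noncomputable section

open Finset Filter Topology

/-! Write `a` for the class of `α`, `S_k f` for the Birkhoff sums of `f` along the rotation by `a`,
and `p`, `q` for the two jump probabilities. The walk is reversible with conductances `exp(S_k f(x))
q(x)`. These stay bounded along the return times of `a`, so the walk is recurrent to the right.
Hence for `k ≥ 1` the expected number of visits to `k` during an excursion is exactly `exp(S_k f(x))
q(x) / q(x + k a)` (`toReal_excursionWeight`). After splitting by parity, the integrals against the
odd and even measures become ratios of weighted orbit sums `∑_{j<n} exp(S_j g) ψ(· + j b)`, with `b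
= 2a`, `g = f + f(· + a)` and `ψ` divided by `q`. In the even case the site `0` needs a bounded
correction.

A limit of normalized orbit averages is a normalized positive functional `Λ` with `Λ(exp(g) ψ(· +
b)) = Λ(ψ)`. Such conformal functionals are unique. By Denjoy-Koksma, at return times the orbit sums
started at two points are proportional up to a factor depending only on the variation of `g`
(`orbitSum_mul_le`). Thus any two conformal functionals dominate each other up to a constant, and a
minorization argument removes the constant (`IsConformal.eq`). Compactness then gives uniform
convergence of the averages (`IsConformal.eventually_abs_sub_lt`).

It remains to see that `ψ ↦ ∫ q ψ dμ` is conformal up to normalization. Stationarity says that the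
net flux of `μ` is rotation invariant, hence a multiple `c` of Haar measure. If `c ≠ 0`, the
integrals of `exp(S_n f)` against `q μ` would drift at least linearly in `n`, whereas Denjoy-Koksma
bounds them along return times (`IsStationary.flux_eq_zero`). So the flux vanishes, which is
conformality for `(a, f)`, and applying it twice gives `(b, g)`. -/

/-! ### Variation majorants -/

/-- The increments of the lift of `g` to `ℝ` are bounded by those of `v`, and `v` increases by `V`
over a period. -/
structure VarMajorant (g : UnitAddCircle → ℝ) (v : ℝ → ℝ) (V : ℝ) : Prop where
  period : ∀ t, v (t + 1) = v t + V
  le : ∀ s t : ℝ, s ≤ t → |g (t : UnitAddCircle) - g (s : UnitAddCircle)| ≤ v t - v s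

namespace VarMajorant

variable {g h : UnitAddCircle → ℝ} {v w : ℝ → ℝ} {V W : ℝ}

theorem mono (hg : VarMajorant g v V) : Monotone v := fun s t hst =>
  sub_nonneg.1 ((abs_nonneg _).trans (hg.le s t hst))

theorem abs_sub_le (hg : VarMajorant g v V) {a b s t : ℝ} (has : a ≤ s) (hsb : s ≤ b)
    (hat : a ≤ t) (htb : t ≤ b) :
    |g (t : UnitAddCircle) - g (s : UnitAddCircle)| ≤ v b - v a := by
  rcases le_total s t with hst | hst
  · linarith [hg.le s t hst, hg.mono has, hg.mono htb]
  · rw [abs_sub_comm]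
    linarith [hg.le t s hst, hg.mono hat, hg.mono hsb]

theorem add (hg : VarMajorant g v V) (hh : VarMajorant h w W) :
    VarMajorant (fun x => g x + h x) (fun t => v t + w t) (V + W) where
  period t := by rw [hg.period, hh.period]; ring
  le s t hst := by
    have h1 := hg.le s t hst
    have h2 := hh.le s t hst
    rw [abs_le] at *
    constructor <;> linarith

theorem comp_add (hg : VarMajorant g v V) (c : ℝ) :
    VarMajorant (fun x => g (x + (c : UnitAddCircle))) (fun t => v (t + c)) V where
  period t := by rw [add_right_comm, hg.period]
  le s t hst := by
    have := hg.le (s + c) (t + c) (by linarith)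
    rwa [AddCircle.coe_add, AddCircle.coe_add] at this

end VarMajorant

theorem HasBoundedVariation.exists_varMajorant {f : C(UnitAddCircle, ℝ)}
    (hf : HasBoundedVariation f) : ∃ v V, VarMajorant f v V := by
  set G : ℝ → ℝ := fun t => f (t : UnitAddCircle) with hG
  have hloc : LocallyBoundedVariationOn G (Set.Icc 0 1) := hf.locallyBoundedVariationOn
  set w : ℝ → ℝ := variationOnFromTo G (Set.Icc 0 1) 0 with hw
  have hle : ∀ s t : ℝ, 0 ≤ s → s ≤ t → t ≤ 1 → |G t - G s| ≤ w t - w s := by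
    intro s t hs hst ht
    have hs' : s ∈ Set.Icc (0 : ℝ) 1 := ⟨hs, hst.trans ht⟩
    have ht' : t ∈ Set.Icc (0 : ℝ) 1 := ⟨hs.trans hst, ht⟩
    rw [hw, variationOnFromTo.sub_right hloc ⟨le_rfl, zero_le_one⟩ ht' hs',
      variationOnFromTo.eq_of_le _ _ hst, ← Real.dist_eq, dist_edist]
    exact ENNReal.toReal_mono (hloc s t hs' ht')
      (eVariationOn.edist_le _ ⟨ht', hst, le_rfl⟩ ⟨hs', le_rfl, hst⟩)
  have hw0 : w 0 = 0 := variationOnFromTo.self _ _ _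
  have hfr : ∀ t : ℝ, f (t : UnitAddCircle) = G (Int.fract t) := by
    intro t
    have h1 : ((Int.fract t : ℝ) : UnitAddCircle) = (t : UnitAddCircle) := by
      rw [← sub_eq_zero, ← AddCircle.coe_sub, AddCircle.coe_eq_zero_iff]
      exact ⟨-⌊t⌋, by rw [Int.fract]; simp⟩
    rw [hG]
    simp only [h1]
  have hG1 : G 1 = G 0 := by
    simp only [hG]
    rw [AddCircle.coe_period, QuotientAddGroup.mk_zero]
  -- The variation function on `[0, 1]`, continued to `ℝ` by adding one total variation per period.
  refine ⟨fun t => ⌊t⌋ * w 1 + w (Int.fract t), w 1, fun t => ?_, fun s t hst => ?_⟩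
  · simp only [Int.floor_add_one, Int.fract_add_one]
    push_cast
    ring
  · rw [hfr, hfr]
    have hs0 := Int.fract_nonneg s
    have hs1 := (Int.fract_lt_one s).le
    have ht0 := Int.fract_nonneg t
    have ht1 := (Int.fract_lt_one t).le
    rcases (Int.floor_mono hst).eq_or_lt with h | h
    · have h2 : Int.fract s ≤ Int.fract t := by
        have h3 : ((⌊s⌋ : ℤ) : ℝ) = ⌊t⌋ := by rw [h]
        simp only [Int.fract]
        linarith
      have := hle _ _ hs0 h2 ht1
      simp only [h]
      linarith
    -- An integer separates `s` and `t`: the increment passes through it, using `G 1 = G 0`.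
    · have h1 := hle _ _ hs0 hs1 le_rfl
      have h2 := hle _ _ le_rfl ht0 ht1
      have h3 : w 0 ≤ w 1 := by
        linarith [(abs_nonneg _).trans (hle 0 1 le_rfl zero_le_one le_rfl)]
      have h4 : ((⌊s⌋ : ℤ) : ℝ) + 1 ≤ ⌊t⌋ := by exact_mod_cast h
      rw [abs_le] at *
      constructor <;> nlinarith

/-! ### Return times of a rotation -/

/-- The oscillations of `g` at scale `2 / q` along `q` steps of the rotation by `b` add up to at
most `B`. -/
def OscBound (b : UnitAddCircle) (g : UnitAddCircle → ℝ) (q : ℕ) (B : ℝ) : Prop :=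
  ∀ (x : UnitAddCircle) (u : ℕ → ℝ), (∀ j, |u j| ≤ 2 / q) →
    ∑ j ∈ range q, |g (x + j • b + (u j : UnitAddCircle)) - g (x + j • b)| ≤ B

/-- The rotation by `b` returns within `1 / q` after `q` steps, and the first `q` points of each
orbit are `2 / q`-dense and evenly spread. -/
structure IsReturnTime (b : UnitAddCircle) (q : ℕ) : Prop where
  pos : 0 < q
  near : ∃ δ : ℝ, |δ| ≤ 1 / q ∧ q • b = (δ : UnitAddCircle)
  dense : ∀ x y : UnitAddCircle, ∃ k < q, ∃ s : ℝ, |s| ≤ 2 / q ∧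
    y = x + k • b + (s : UnitAddCircle)
  osc : ∀ g v V, VarMajorant g v V → OscBound b g q (6 * V)

/-- Each additional shift by `1 / q` telescopes over the grid to one full period, contributing `V`.
-/
theorem sum_shift_eq_mul {v : ℝ → ℝ} {V : ℝ} (hv : ∀ t, v (t + 1) = v t + V) {q : ℕ} (hq : 0 < q)
    (y : ℝ) (m : ℕ) :
    ∑ i ∈ range q, (v (y + i / q + m / q) - v (y + i / q)) = m * V := by
  have hq' : (q : ℝ) ≠ 0 := by positivity
  induction m with
  | zero => simp
  | succ m ih =>
    have h1 : ∑ i ∈ range q, (v (y + m / q + ((i + 1 : ℕ) : ℝ) / q) - v (y + m / q + (i : ℝ) / q))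
        = V := by
      rw [sum_range_sub (fun i : ℕ => v (y + m / q + (i : ℝ) / q)), div_self hq', hv]
      simp
    rw [Nat.cast_succ, add_mul, one_mul, ← ih]
    conv_rhs => rw [← h1]
    rw [← sum_add_distrib]
    refine sum_congr rfl fun i _ => ?_
    have e1 : y + m / q + ((i + 1 : ℕ) : ℝ) / q = y + i / q + ((m : ℝ) + 1) / q := by
      push_cast; ring
    have e2 : y + m / q + (i : ℝ) / q = y + i / q + m / q := by ring
    rw [e1, e2]
    ring

theorem periodic_add_int_div {H : ℝ → ℝ} (hH : ∀ t, H (t + 1) = H t) {q : ℕ} (hq : 0 < q) (x : ℝ)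
    (m n : ℤ) (hmn : (m : ZMod q) = n) : H (x + m / q) = H (x + n / q) := by
  have hq' : (q : ℝ) ≠ 0 := by positivity
  rw [ZMod.intCast_eq_intCast_iff_dvd_sub] at hmn
  obtain ⟨c, hc⟩ := hmn
  have h2 : x + n / q = x + m / q + c * (1 : ℝ) := by
    have h3 : (n : ℝ) - m = q * c := by exact_mod_cast hc
    field_simp
    linarith
  have hP : Function.Periodic H 1 := hH
  rw [h2, hP.int_mul c]

/-- Multiplication by the unit `p` permutes the residues modulo `q`. -/
theorem sum_rational_rotation {H : ℝ → ℝ} (hH : ∀ t, H (t + 1) = H t) {q : ℕ} (hq : 0 < q) (p : ℤ)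
    (hpq : IsUnit (p : ZMod q)) (x : ℝ) :
    ∑ j ∈ range q, H (x + j * p / q) = ∑ i ∈ range q, H (x + i / q) := by
  have : NeZero q := ⟨hq.ne'⟩
  obtain ⟨u, hu⟩ := hpq
  set F : ZMod q → ℝ := fun j => H (x + (j.val : ℝ) / q) with hF
  have hcast : ∀ m : ℤ, H (x + m / q) = F (m : ZMod q) := by
    intro m
    have := periodic_add_int_div hH hq x m (((m : ZMod q).val : ℕ) : ℤ) (by simp)
    rw [this, hF]
    simp
  have hsum : ∀ F' : ZMod q → ℝ, ∑ j ∈ range q, F' (j : ZMod q) = ∑ j : ZMod q, F' j := by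
    intro F'
    refine sum_bij (fun j _ => (j : ZMod q)) (by simp) ?_ ?_ (by simp)
    · intro a ha b hb hab
      rw [ZMod.natCast_eq_natCast_iff'] at hab
      rwa [Nat.mod_eq_of_lt (mem_range.1 ha), Nat.mod_eq_of_lt (mem_range.1 hb)] at hab
    · intro b _
      exact ⟨b.val, mem_range.2 (ZMod.val_lt b), by simp⟩
  have h1 : ∀ j : ℕ, H (x + j * p / q) = F ((j : ZMod q) * u) := by
    intro j
    have := hcast (j * p)
    push_cast at this
    rw [this, hu]
  have h2 : ∀ j : ℕ, H (x + j / q) = F (j : ZMod q) := by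
    intro j
    have := hcast j
    push_cast at this
    exact this
  simp_rw [h1, h2]
  rw [hsum (fun j => F (j * u)), hsum F]
  exact Fintype.sum_equiv u.mulRight _ _ fun j => by simp

theorem coe_eq_coe_of_sub_eq_int {s t : ℝ} (n : ℤ) (h : s - t = n) :
    (s : UnitAddCircle) = (t : UnitAddCircle) := by
  rw [← sub_eq_zero, ← AddCircle.coe_sub, AddCircle.coe_eq_zero_iff]
  exact ⟨n, by simp [h]⟩

theorem isReturnTime_of_approx {β : ℝ} {q : ℕ} (hq : 0 < q) {p : ℤ} (hpq : IsUnit (p : ZMod q))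
    (happ : |β - p / q| < 1 / (q : ℝ) ^ 2) : IsReturnTime (β : UnitAddCircle) q := by
  have hq' : (0 : ℝ) < q := by positivity
  have herr : ∀ j : ℕ, j ≤ q → |j * β - j * p / q| ≤ 1 / q := by
    intro j hj
    have hj' : (j : ℝ) ≤ q := by exact_mod_cast hj
    have h1 : (j : ℝ) * β - j * p / q = j * (β - p / q) := by ring
    rw [h1, abs_mul, Nat.abs_cast]
    calc (j : ℝ) * |β - p / q| ≤ q * (1 / (q : ℝ) ^ 2) := by gcongr
      _ = 1 / q := by field_simp
  have hsmul : ∀ j : ℕ, j • (β : UnitAddCircle) = ((j * β : ℝ) : UnitAddCircle) := by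
    intro j
    rw [← AddCircle.coe_nsmul, nsmul_eq_mul]
  refine ⟨hq, ⟨q * β - p, ?_, ?_⟩, ?_, ?_⟩
  · have := herr q le_rfl
    rwa [mul_div_assoc, mul_div_cancel₀ _ hq'.ne'] at this
  · rw [hsmul]
    exact coe_eq_coe_of_sub_eq_int p (by ring)
  · intro x y
    have : NeZero q := ⟨hq.ne'⟩
    induction x using QuotientAddGroup.induction_on with | H x => ?_
    induction y using QuotientAddGroup.induction_on with | H y => ?_
    obtain ⟨u, hu⟩ := hpq
    set d := y - x with hd
    set i : ℤ := ⌊q * d⌋ with hi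
    -- Chosen so that `k p ≡ i` modulo `q`. Rounding `d` to `i / q` and replacing `β` by `p / q`
    -- each cost `1 / q`.
    set k : ℕ := ((i : ZMod q) * (u⁻¹ : (ZMod q)ˣ)).val with hk
    have hkq : k < q := ZMod.val_lt _
    have hkp : ((k * p : ℤ) : ZMod q) = (i : ℤ) := by
      push_cast
      rw [hk, ← hu]
      simp
    rw [ZMod.intCast_eq_intCast_iff_dvd_sub] at hkp
    obtain ⟨c, hc⟩ := hkp
    have hc' : (i : ℝ) - k * p = q * c := by exact_mod_cast hc
    refine ⟨k, hkq, (d - i / q) + (k * p / q - k * β), ?_, ?_⟩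
    · have h1 := herr k hkq.le
      have h2 : |d - i / q| ≤ 1 / q := by
        have h3 : d - i / q = (q * d - i) / q := by field_simp
        rw [h3, abs_div, abs_of_pos hq']
        gcongr
        rw [abs_le]
        constructor <;> linarith [Int.floor_le (q * d), Int.lt_floor_add_one (q * d)]
      have h3 := abs_add_le (d - i / q) (k * p / q - k * β)
      rw [abs_sub_comm (k * p / q : ℝ)] at h3
      have h4 : (2 : ℝ) / q = 1 / q + 1 / q := by ring
      linarith
    · rw [hsmul]
      change (y : UnitAddCircle) = (x : UnitAddCircle) + _ + _
      rw [← AddCircle.coe_add, ← AddCircle.coe_add]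
      refine coe_eq_coe_of_sub_eq_int c ?_
      have : (c : ℝ) = (i - k * p) / q := by rw [hc']; field_simp
      rw [this, hd]
      ring
  · intro g v V hg x u hu
    induction x using QuotientAddGroup.induction_on with | H x => ?_
    -- The radius `3 / q` is `1 / q` for replacing `j β` by `j p / q` plus `2 / q` for `u j`. The
    -- windows have width `6 / q` and are centred on a `1 / q`-grid, whence the total `6 V`.
    set H : ℝ → ℝ := fun t => v (t + 3 / q) - v (t - 3 / q) with hH
    have hper : ∀ t, H (t + 1) = H t := by
      intro t
      have h1 : t + 1 + 3 / q = t + 3 / q + 1 := by ring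
      have h2 : t + 1 - 3 / q = t - 3 / q + 1 := by ring
      simp only [hH]
      rw [h1, h2, hg.period, hg.period]
      ring
    have hterm : ∀ j ∈ range q, |g ((x : UnitAddCircle) + j • (β : UnitAddCircle)
        + (u j : UnitAddCircle)) - g ((x : UnitAddCircle) + j • (β : UnitAddCircle))|
        ≤ H (x + j * p / q) := by
      intro j hj
      rw [hsmul, ← AddCircle.coe_add, ← AddCircle.coe_add]
      have h1 := abs_le.1 (herr j (mem_range.1 hj).le)
      have h2 := abs_le.1 (hu j)
      have h3 : (3 : ℝ) / q = 1 / q + 2 / q := by ring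
      have h4 : (0 : ℝ) < 1 / q := by positivity
      have h5 : (0 : ℝ) < 2 / q := by positivity
      apply hg.abs_sub_le <;> linarith
    refine (sum_le_sum hterm).trans (le_of_eq ?_)
    rw [sum_rational_rotation hper hq p hpq]
    have := sum_shift_eq_mul hg.period hq (x - 3 / q) 6
    push_cast at this
    rw [← this]
    refine sum_congr rfl fun i _ => ?_
    simp only [hH]
    congr 2 <;> ring

/-- Dirichlet gives infinitely many good reduced fractions. A fixed denominator admits only finitely
many numerators, so the denominators are unbounded. -/
theorem frequently_isReturnTime {β : ℝ} (hβ : Irrational β) :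
    ∃ᶠ q in atTop, IsReturnTime (β : UnitAddCircle) q := by
  rw [Nat.frequently_atTop_iff_infinite]
  have hinf := Real.infinite_rat_abs_sub_lt_one_div_den_sq_of_irrational hβ
  have himg : ∀ r ∈ {r : ℚ | |β - r| < 1 / (r.den : ℝ) ^ 2},
      r.den ∈ {q : ℕ | IsReturnTime (β : UnitAddCircle) q} := by
    intro r hr
    refine isReturnTime_of_approx (p := r.num) r.pos ?_ ?_
    · have := (ZMod.isUnit_iff_coprime r.num.natAbs r.den).2 r.reduced
      rcases Int.natAbs_eq r.num with h | h
      · rw [h, Int.cast_natCast]; exact this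
      · rw [h, Int.cast_neg, Int.cast_natCast]; exact this.neg
    · have h2 : ((r.num : ℝ) / r.den) = r := by exact_mod_cast r.num_div_den
      rw [h2]
      exact hr
  intro hfin
  refine hinf (Set.Finite.of_finite_fibers Rat.den (hfin.subset ?_) ?_)
  · rintro _ ⟨r, hr, rfl⟩
    exact himg r hr
  · rintro d ⟨r₀, hr₀, rfl⟩
    have hd : (0 : ℝ) < r₀.den := by exact_mod_cast r₀.pos
    refine Set.Finite.of_finite_image (f := Rat.num)
      ((Set.finite_Icc ⌊r₀.den * β - 1⌋ ⌈r₀.den * β + 1⌉).subset ?_) ?_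
    · rintro _ ⟨r, ⟨hr, hrd⟩, rfl⟩
      simp only [Set.mem_preimage, Set.mem_singleton_iff] at hrd
      simp only [Set.mem_ofPred_eq] at hr
      rw [hrd] at hr
      have h2 : (r : ℝ) = r.num / r₀.den := by
        rw [← hrd]; exact_mod_cast r.num_div_den.symm
      have hd1 : (1 : ℝ) ≤ r₀.den := by exact_mod_cast r₀.pos
      have h3 : |r₀.den * β - r.num| ≤ 1 := by
        have h4 : r₀.den * β - r.num = r₀.den * (β - r) := by rw [h2]; field_simp
        rw [h4, abs_mul, Nat.abs_cast]
        calc (r₀.den : ℝ) * |β - r| ≤ r₀.den * (1 / (r₀.den : ℝ) ^ 2) := by gcongr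
          _ = 1 / r₀.den := by field_simp
          _ ≤ 1 := by rw [div_le_one hd]; exact hd1
      rw [abs_le] at h3
      constructor
      · have : ((⌊r₀.den * β - 1⌋ : ℤ) : ℝ) ≤ r.num := by
          linarith [Int.floor_le (r₀.den * β - 1)]
        exact_mod_cast this
      · have : (r.num : ℝ) ≤ ⌈r₀.den * β + 1⌉ := by
          linarith [Int.le_ceil (r₀.den * β + 1)]
        exact_mod_cast this
    · rintro r ⟨_, hr⟩ r' ⟨_, hr'⟩ hrr'
      simp only [Set.mem_preimage, Set.mem_singleton_iff] at hr hr'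
      exact Rat.ext hrr' (hr.trans hr'.symm)

/-! ### Birkhoff sums along a rotation -/

/-- The Birkhoff sum of `g` along `n` steps of the rotation by `b`. -/
def rotationSum (b : UnitAddCircle) (g : UnitAddCircle → ℝ) (n : ℕ) (x : UnitAddCircle) : ℝ :=
  ∑ i ∈ range n, g (x + i • b)

section RotationSum

variable {b : UnitAddCircle} {g : UnitAddCircle → ℝ} {q : ℕ} {B : ℝ}

@[simp]
theorem rotationSum_zero (x : UnitAddCircle) : rotationSum b g 0 x = 0 := rfl

theorem rotationSum_add (m n : ℕ) (x : UnitAddCircle) :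
    rotationSum b g (m + n) x = rotationSum b g m x + rotationSum b g n (x + m • b) := by
  simp only [rotationSum, sum_range_add, add_smul, add_assoc]

theorem rotationSum_succ' (n : ℕ) (x : UnitAddCircle) :
    rotationSum b g (n + 1) x = g x + rotationSum b g n (x + b) := by
  rw [add_comm, rotationSum_add]
  simp [rotationSum]

theorem rotationSum_succ (n : ℕ) (x : UnitAddCircle) :
    rotationSum b g (n + 1) x = rotationSum b g n x + g (x + n • b) :=
  sum_range_succ _ _

theorem continuous_rotationSum (hg : Continuous g) (n : ℕ) : Continuous (rotationSum b g n) :=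
  continuous_finsetSum _ fun _ _ => hg.comp (continuous_add_const _)

theorem integrable_of_continuous {X : Type*} [TopologicalSpace X] [CompactSpace X]
    [MeasurableSpace X] [OpensMeasurableSpace X] {μ : Measure X} [IsFiniteMeasure μ] {h : X → ℝ}
    (hh : Continuous h) : Integrable h μ :=
  hh.integrable_of_hasCompactSupport (HasCompactSupport.of_compactSpace h)

instance isProbabilityMeasure_circle : IsProbabilityMeasure (volume : Measure UnitAddCircle) :=
  ⟨UnitAddCircle.measure_univ⟩

theorem integral_rotationSum (hg : Continuous g) (n : ℕ) :
    ∫ x, rotationSum b g n x = n * ∫ x, g x := by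
  simp only [rotationSum]
  have h1 : ∀ i ∈ range n, Integrable (fun x : UnitAddCircle => g (x + i • b)) volume :=
    fun i _ => integrable_of_continuous (hg.comp (continuous_add_const _))
  have h2 : ∀ c : UnitAddCircle, ∫ x : UnitAddCircle, g (x + c) = ∫ x : UnitAddCircle, g x :=
    fun c => integral_add_right_eq_self g c
  rw [integral_finsetSum (range n) h1]
  simp only [h2, sum_const, card_range, nsmul_eq_mul]

theorem IsReturnTime.one_div_le (hq : IsReturnTime b q) : (1 : ℝ) / q ≤ 2 / q := by
  have := hq.pos
  gcongr
  norm_num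

theorem OscBound.abs_rotationSum_add_sub_le (hB : OscBound b g q B) {n : ℕ} (hn : n ≤ q)
    (x : UnitAddCircle) {s : ℝ} (hs : |s| ≤ 2 / q) :
    |rotationSum b g n (x + (s : UnitAddCircle)) - rotationSum b g n x| ≤ B := by
  rw [rotationSum, rotationSum, ← sum_sub_distrib]
  calc |∑ i ∈ range n, (g (x + s + i • b) - g (x + i • b))|
      ≤ ∑ i ∈ range n, |g (x + s + i • b) - g (x + i • b)| := abs_sum_le_sum_abs _ _
    _ ≤ ∑ i ∈ range q, |g (x + s + i • b) - g (x + i • b)| :=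
        sum_le_sum_of_subset_of_nonneg (range_mono hn) fun _ _ _ => abs_nonneg _
    _ ≤ B := by
        simp_rw [add_right_comm x (s : UnitAddCircle)]
        exact hB x (fun _ => s) fun _ => hs

/-- The cocycle identity, read in both orders, gives `S_q(x + k b) - S_q(x) = S_k(x + q b) -
S_k(x)`. Here `q b` is a small shift, costing `B`; the remaining shift `s` costs another `B`. -/
theorem IsReturnTime.abs_rotationSum_sub_le (hq : IsReturnTime b q) (hB : OscBound b g q B)
    (x y : UnitAddCircle) : |rotationSum b g q y - rotationSum b g q x| ≤ 2 * B := by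
  obtain ⟨k, hk, s, hs, rfl⟩ := hq.dense x y
  obtain ⟨δ, hδ, hqδ⟩ := hq.near
  have h1 := hB.abs_rotationSum_add_sub_le le_rfl (x + k • b) hs
  have h2 := hB.abs_rotationSum_add_sub_le hk.le x (hδ.trans hq.one_div_le)
  have h3 := rotationSum_add (b := b) (g := g) k q x
  have h4 := rotationSum_add (b := b) (g := g) q k x
  rw [add_comm, h4, hqδ] at h3
  rw [abs_le] at *
  constructor <;> linarith

/-- The Denjoy-Koksma inequality, obtained by averaging the previous comparison over `y`. -/
theorem IsReturnTime.abs_rotationSum_sub_integral_le (hq : IsReturnTime b q)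
    (hB : OscBound b g q B) (hg : Continuous g) (x : UnitAddCircle) :
    |rotationSum b g q x - q * ∫ y, g y| ≤ 2 * B := by
  rw [← integral_rotationSum (b := b) hg]
  have hint : Integrable (fun y => rotationSum b g q x - rotationSum b g q y) :=
    integrable_of_continuous (continuous_const.sub (continuous_rotationSum hg q))
  have h1 : rotationSum b g q x - ∫ y, rotationSum b g q y
      = ∫ y, (rotationSum b g q x - rotationSum b g q y) := by
    rw [integral_sub (integrable_const _)
      (integrable_of_continuous (continuous_rotationSum hg q))]
    simp
  rw [h1]
  refine (abs_integral_le_integral_abs).trans ?_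
  calc ∫ y, |rotationSum b g q x - rotationSum b g q y|
      ≤ ∫ _ : UnitAddCircle, 2 * B :=
        integral_mono hint.abs (integrable_const _) fun y => hq.abs_rotationSum_sub_le hB y x
    _ = 2 * B := by simp

end RotationSum

theorem eventually_abs_add_sub_le {ψ : UnitAddCircle → ℝ} (hψ : Continuous ψ) {η : ℝ}
    (hη : 0 < η) : ∀ᶠ q : ℕ in atTop, ∀ (x : UnitAddCircle) (s : ℝ), |s| ≤ 2 / q →
      |ψ (x + (s : UnitAddCircle)) - ψ x| ≤ η := by
  have huc := CompactSpace.uniformContinuous_of_continuous hψ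
  obtain ⟨δ, hδ, h⟩ := Metric.uniformContinuous_iff.1 huc η hη
  have hlim : Tendsto (fun q : ℕ => (2 : ℝ) / q) atTop (𝓝 0) :=
    tendsto_const_div_atTop_nhds_zero_nat 2
  filter_upwards [hlim.eventually (gt_mem_nhds hδ)] with q hq x s hs
  have h1 : dist (x + (s : UnitAddCircle)) x < δ := by
    rw [dist_eq_norm, add_sub_cancel_left]
    refine lt_of_le_of_lt ?_ (hs.trans_lt hq)
    exact QuotientAddGroup.norm_mk_le_norm
  exact (h h1).le

/-! ### Weighted orbit sums -/

section OrbitSum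

variable {b : UnitAddCircle} {g : C(UnitAddCircle, ℝ)} {q : ℕ} {B : ℝ}

/-- The `n`-th iterate of the weighted composition operator `ψ ↦ exp(g) ψ(· + b)`. -/
def transfer (b : UnitAddCircle) (g : C(UnitAddCircle, ℝ)) (n : ℕ) :
    C(UnitAddCircle, ℝ) →ₗ[ℝ] C(UnitAddCircle, ℝ) where
  toFun ψ := ⟨fun x => Real.exp (rotationSum b g n x) * ψ (x + n • b),
    (Real.continuous_exp.comp (continuous_rotationSum g.continuous n)).mul
      (ψ.continuous.comp (continuous_add_const _))⟩
  map_add' ψ χ := by ext x; simp [mul_add]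
  map_smul' c ψ := by ext x; simp [mul_left_comm]

theorem transfer_apply (n : ℕ) (ψ : C(UnitAddCircle, ℝ)) (x : UnitAddCircle) :
    transfer b g n ψ x = Real.exp (rotationSum b g n x) * ψ (x + n • b) := rfl

theorem transfer_one_transfer (n : ℕ) (ψ : C(UnitAddCircle, ℝ)) :
    transfer b g 1 (transfer b g n ψ) = transfer b g (n + 1) ψ := by
  ext x
  have h1 : rotationSum b g 1 x = g x := by simp [rotationSum]
  simp only [transfer_apply]
  rw [h1, rotationSum_succ', Real.exp_add, one_smul, add_assoc, ← succ_nsmul', mul_assoc]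

/-- The sum `∑_{j < n} exp(S_j g) ψ(· + j b)`. -/
def orbitSum (b : UnitAddCircle) (g : C(UnitAddCircle, ℝ)) (n : ℕ) :
    C(UnitAddCircle, ℝ) →ₗ[ℝ] C(UnitAddCircle, ℝ) :=
  ∑ j ∈ range n, transfer b g j

theorem orbitSum_apply (n : ℕ) (ψ : C(UnitAddCircle, ℝ)) (x : UnitAddCircle) :
    orbitSum b g n ψ x
      = ∑ j ∈ range n, Real.exp (rotationSum b g j x) * ψ (x + j • b) := by
  simp [orbitSum, ContinuousMap.sum_apply, transfer_apply]

theorem orbitSum_one_apply (n : ℕ) (x : UnitAddCircle) :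
    orbitSum b g n 1 x = ∑ j ∈ range n, Real.exp (rotationSum b g j x) := by
  simp [orbitSum_apply]

theorem orbitSum_one_pos {n : ℕ} (hn : 0 < n) (x : UnitAddCircle) : 0 < orbitSum b g n 1 x := by
  rw [orbitSum_one_apply]
  exact sum_pos (fun _ _ => Real.exp_pos _) ⟨0, mem_range.2 hn⟩

theorem orbitSum_one_nonneg (n : ℕ) (x : UnitAddCircle) : 0 ≤ orbitSum b g n 1 x := by
  rw [orbitSum_one_apply]
  exact sum_nonneg fun _ _ => (Real.exp_pos _).le

/-- Telescoping: orbit sums are conformal up to two boundary terms. -/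
theorem orbitSum_transfer_one (n : ℕ) (ψ : C(UnitAddCircle, ℝ)) (x : UnitAddCircle) :
    orbitSum b g n (transfer b g 1 ψ) x - orbitSum b g n ψ x
      = Real.exp (rotationSum b g n x) * ψ (x + n • b) - ψ x := by
  have h1 : ∀ j : ℕ, Real.exp (rotationSum b g j x) * transfer b g 1 ψ (x + j • b)
      = Real.exp (rotationSum b g (j + 1) x) * ψ (x + (j + 1) • b) := by
    intro j
    have h2 : rotationSum b g 1 (x + j • b) = g (x + j • b) := by simp [rotationSum]
    rw [transfer_apply, h2, rotationSum_succ, Real.exp_add, one_smul, succ_nsmul]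
    rw [← add_assoc, mul_assoc]
  rw [orbitSum_apply, orbitSum_apply, ← sum_sub_distrib]
  simp_rw [h1]
  rw [sum_range_sub fun j => Real.exp (rotationSum b g j x) * ψ (x + j • b)]
  simp

theorem sum_window (F : ℕ → ℝ) {k q : ℕ} (hk : k ≤ q) :
    ∑ j ∈ range q, F (k + j) = ∑ i ∈ range k, F (q + i) + ∑ j ∈ Ico k q, F j := by
  have h1 := sum_range_add F k q
  have h2 := sum_range_add F q k
  have h3 := sum_range_add_sum_Ico F hk
  rw [add_comm k q] at h1
  linarith

theorem sum_split (F : ℕ → ℝ) {k q : ℕ} (hk : k ≤ q) :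
    ∑ j ∈ range q, F j = ∑ i ∈ range k, F i + ∑ j ∈ Ico k q, F j :=
  (sum_range_add_sum_Ico F hk).symm

/-- A Harnack-type comparison. With `y = x + k b + s`, the weights at `y` are those at `x` in the
window `[k, k + q)`, divided by `exp(S_k)`, at a cost of `B` in the exponent. Wrapping indices `q +
i` back to `i` costs `2 B`, since `g` has mean zero. This `3 B` is paid once for each of the two
orbit sums, and the factors `exp(∓ S_k)` cancel. One `η` pays for the shift by `s`, the other for
the shift by `q b`. -/
theorem orbitSum_mul_le (hq : IsReturnTime b q) (hB : OscBound b g q B)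
    (hmean : ∫ x, g x = 0) {ψ : C(UnitAddCircle, ℝ)} (hψ : ∀ x, 0 ≤ ψ x) {η : ℝ} (hη : 0 ≤ η)
    (hψη : ∀ (x : UnitAddCircle) (s : ℝ), |s| ≤ 2 / q → |ψ (x + (s : UnitAddCircle)) - ψ x| ≤ η)
    (x y : UnitAddCircle) :
    orbitSum b g q ψ y * orbitSum b g q 1 x
      ≤ Real.exp (6 * B) * (orbitSum b g q ψ x + 2 * η * orbitSum b g q 1 x)
        * orbitSum b g q 1 y := by
  obtain ⟨k, hk, s, hs, rfl⟩ := hq.dense x y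
  obtain ⟨δ, hδ, hqδ⟩ := hq.near
  have hB0 : 0 ≤ B := by
    have := hB.abs_rotationSum_add_sub_le le_rfl x hs
    exact (abs_nonneg _).trans this
  set S : ℕ → ℝ := fun j => rotationSum b g j x with hS
  have hSq : ∀ z, |rotationSum b g q z| ≤ 2 * B := by
    intro z
    have := hq.abs_rotationSum_sub_integral_le hB g.continuous z
    rwa [hmean, mul_zero, sub_zero] at this
  have hshift : ∀ i : ℕ, |S (i + q) - S i| ≤ 2 * B := by
    intro i
    have := hSq (x + i • b)
    have h1 := rotationSum_add (b := b) (g := g) i q x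
    rwa [← sub_eq_iff_eq_add'.2 h1] at this
  have hpt : ∀ j : ℕ, x + k • b + (s : UnitAddCircle) + j • b
      = x + (k + j) • b + (s : UnitAddCircle) := by
    intro j
    rw [add_smul]
    abel
  have hSy : ∀ j ≤ q, |rotationSum b g j (x + k • b + (s : UnitAddCircle)) - (S (k + j) - S k)|
      ≤ B := by
    intro j hj
    have := hB.abs_rotationSum_add_sub_le hj (x + k • b) hs
    rwa [← sub_eq_iff_eq_add'.2 (rotationSum_add (b := b) (g := g) k j x)] at this
  have hupper : orbitSum b g q ψ (x + k • b + (s : UnitAddCircle))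
      ≤ Real.exp (3 * B - S k) * (orbitSum b g q ψ x + 2 * η * orbitSum b g q 1 x) := by
    have h1 : ∀ j ∈ range q,
        Real.exp (rotationSum b g j (x + k • b + (s : UnitAddCircle)))
          * ψ (x + k • b + (s : UnitAddCircle) + j • b)
        ≤ Real.exp (B - S k) * (Real.exp (S (k + j)) * (ψ (x + (k + j) • b) + η)) := by
      intro j hj
      rw [← mul_assoc, ← Real.exp_add, hpt]
      refine mul_le_mul (Real.exp_le_exp.2 ?_) ?_ (hψ _) (Real.exp_pos _).le
      · linarith [(abs_le.1 (hSy j (mem_range.1 hj).le)).2]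
      · linarith [(abs_le.1 (hψη (x + (k + j) • b) s hs)).2]
    have h2 : ∑ j ∈ range q, Real.exp (S (k + j)) * (ψ (x + (k + j) • b) + η)
        ≤ Real.exp (2 * B) * ∑ j ∈ range q, Real.exp (S j) * (ψ (x + j • b) + 2 * η) := by
      rw [sum_window (fun j => Real.exp (S j) * (ψ (x + j • b) + η)) hk.le,
        sum_split (fun j => Real.exp (S j) * (ψ (x + j • b) + 2 * η)) hk.le, mul_add,
        mul_sum, mul_sum]
      refine add_le_add (sum_le_sum fun i _ => ?_) (sum_le_sum fun j _ => ?_)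
      · rw [← mul_assoc, ← Real.exp_add]
        refine mul_le_mul (Real.exp_le_exp.2 ?_) ?_ (add_nonneg (hψ _) hη) (Real.exp_pos _).le
        · linarith [(abs_le.1 (add_comm i q ▸ hshift i)).2]
        · have h3 : x + (q + i) • b = x + i • b + (δ : UnitAddCircle) := by
            rw [add_smul, hqδ]; abel
          rw [h3]
          linarith [(abs_le.1 (hψη (x + i • b) δ (hδ.trans hq.one_div_le))).2]
      · rw [← mul_assoc, ← Real.exp_add]
        refine mul_le_mul (Real.exp_le_exp.2 (by linarith)) (by linarith)
          (add_nonneg (hψ _) hη) (Real.exp_pos _).le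
    have h4 : ∑ j ∈ range q, Real.exp (S j) * (ψ (x + j • b) + 2 * η)
        = orbitSum b g q ψ x + 2 * η * orbitSum b g q 1 x := by
      rw [orbitSum_apply, orbitSum_one_apply, mul_sum, ← sum_add_distrib]
      exact sum_congr rfl fun j _ => by ring
    rw [← h4]
    calc orbitSum b g q ψ (x + k • b + (s : UnitAddCircle))
        ≤ ∑ j ∈ range q,
            Real.exp (B - S k) * (Real.exp (S (k + j)) * (ψ (x + (k + j) • b) + η)) := by
          rw [orbitSum_apply]; exact sum_le_sum h1
      _ = Real.exp (B - S k)
            * ∑ j ∈ range q, Real.exp (S (k + j)) * (ψ (x + (k + j) • b) + η) := by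
          rw [mul_sum]
      _ ≤ Real.exp (B - S k) * (Real.exp (2 * B)
            * ∑ j ∈ range q, Real.exp (S j) * (ψ (x + j • b) + 2 * η)) := by gcongr
      _ = _ := by rw [← mul_assoc, ← Real.exp_add]; congr 2; ring
  have hlower : orbitSum b g q 1 x
      ≤ Real.exp (3 * B + S k) * orbitSum b g q 1 (x + k • b + (s : UnitAddCircle)) := by
    rw [orbitSum_one_apply, orbitSum_one_apply]
    have h1 : ∑ j ∈ range q, Real.exp (S j)
        ≤ Real.exp (2 * B) * ∑ j ∈ range q, Real.exp (S (k + j)) := by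
      rw [sum_window (fun j => Real.exp (S j)) hk.le, sum_split (fun j => Real.exp (S j)) hk.le,
        mul_add, mul_sum, mul_sum]
      refine add_le_add (sum_le_sum fun i _ => ?_) (sum_le_sum fun j _ => ?_)
      · rw [← Real.exp_add]
        refine Real.exp_le_exp.2 ?_
        linarith [(abs_le.1 (add_comm i q ▸ hshift i)).1]
      · rw [← Real.exp_add]
        exact Real.exp_le_exp.2 (by linarith)
    refine h1.trans ?_
    rw [mul_sum, mul_sum]
    refine sum_le_sum fun j hj => ?_
    rw [← Real.exp_add, ← Real.exp_add]
    refine Real.exp_le_exp.2 ?_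
    linarith [(abs_le.1 (hSy j (mem_range.1 hj).le)).1]
  set Y := orbitSum b g q 1 (x + k • b + (s : UnitAddCircle))
  set X := orbitSum b g q ψ x + 2 * η * orbitSum b g q 1 x with hX
  have hX0 : 0 ≤ X := by
    have : 0 ≤ orbitSum b g q ψ x := by
      rw [orbitSum_apply]
      exact sum_nonneg fun _ _ => mul_nonneg (Real.exp_pos _).le (hψ _)
    have := orbitSum_one_nonneg (b := b) (g := g) q x
    positivity
  calc _ ≤ (Real.exp (3 * B - S k) * X) * (Real.exp (3 * B + S k) * Y) :=
        mul_le_mul hupper hlower (orbitSum_one_nonneg _ _) (by positivity)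
    _ = Real.exp (3 * B - S k + (3 * B + S k)) * X * Y := by
        rw [Real.exp_add (3 * B - S k)]; ring
    _ = Real.exp (6 * B) * X * Y := by congr 3; ring

end OrbitSum

/-! ### Conformal functionals -/

/-- Normalized positive functionals `Λ` with `Λ(exp(g) ψ(· + b)) = Λ(ψ)`. -/
structure IsConformal (b : UnitAddCircle) (g : C(UnitAddCircle, ℝ))
    (Λ : C(UnitAddCircle, ℝ) →ₗ[ℝ] ℝ) : Prop where
  nonneg : ∀ ψ : C(UnitAddCircle, ℝ), (∀ x, 0 ≤ ψ x) → 0 ≤ Λ ψ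
  map_one : Λ 1 = 1
  map_transfer : ∀ ψ, Λ (transfer b g 1 ψ) = Λ ψ

section Conformal

variable {b : UnitAddCircle} {g : C(UnitAddCircle, ℝ)} {B : ℝ}
  {Λ Λ' : C(UnitAddCircle, ℝ) →ₗ[ℝ] ℝ}

theorem IsConformal.mono (hΛ : IsConformal b g Λ) {ψ χ : C(UnitAddCircle, ℝ)}
    (h : ∀ x, ψ x ≤ χ x) : Λ ψ ≤ Λ χ := by
  have := hΛ.nonneg (χ - ψ) fun x => by simpa using h x
  rw [map_sub] at this
  linarith

theorem IsConformal.map_orbitSum (hΛ : IsConformal b g Λ) (n : ℕ) (ψ : C(UnitAddCircle, ℝ)) :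
    Λ (orbitSum b g n ψ) = n * Λ ψ := by
  have h : ∀ j : ℕ, Λ (transfer b g j ψ) = Λ ψ := by
    intro j
    induction j with
    | zero =>
      congr 1
      ext x
      simp [transfer_apply]
    | succ j ih => rw [← transfer_one_transfer, hΛ.map_transfer, ih]
  simp [orbitSum, h]

/-- Apply `Λ'` in the variable `x` and `Λ` in the variable `y` to `orbitSum_mul_le`; on orbit sums
of length `q` both just multiply by `q`. -/
theorem IsConformal.le_exp_mul
    (hB : ∃ᶠ q in atTop, IsReturnTime b q ∧ OscBound b g q B) (hmean : ∫ x, g x = 0)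
    (hΛ : IsConformal b g Λ) (hΛ' : IsConformal b g Λ') {ψ : C(UnitAddCircle, ℝ)}
    (hψ : ∀ x, 0 ≤ ψ x) : Λ ψ ≤ Real.exp (6 * B) * Λ' ψ := by
  have hC := Real.exp_pos (6 * B)
  set C := Real.exp (6 * B) with hCdef
  refine le_of_forall_pos_le_add fun ε hε => ?_
  set η := ε / (2 * C) with hη
  have hη0 : 0 < η := by positivity
  obtain ⟨q, ⟨hq, hqB⟩, hqη⟩ :=
    (hB.and_eventually (eventually_abs_add_sub_le ψ.continuous hη0)).exists
  have hq0 : (0 : ℝ) < q := by exact_mod_cast hq.pos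
  have key := orbitSum_mul_le hq hqB hmean hψ hη0.le hqη
  have h1 : ∀ y, q * orbitSum b g q ψ y
      ≤ C * (q * Λ' ψ + 2 * η * q) * orbitSum b g q 1 y := by
    intro y
    have h2 := hΛ'.mono (ψ := orbitSum b g q ψ y • orbitSum b g q 1)
      (χ := (C * orbitSum b g q 1 y) • (orbitSum b g q ψ + (2 * η) • orbitSum b g q 1))
      (fun x => by
        simp only [ContinuousMap.smul_apply, ContinuousMap.add_apply, smul_eq_mul]
        linarith [key x y])
    simp only [map_smul, map_add, smul_eq_mul, hΛ'.map_orbitSum, hΛ'.map_one] at h2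
    linarith
  have h3 := hΛ.mono (ψ := (q : ℝ) • orbitSum b g q ψ)
    (χ := (C * (q * Λ' ψ + 2 * η * q)) • orbitSum b g q 1) (fun y => by
      simp only [ContinuousMap.smul_apply, smul_eq_mul]
      exact h1 y)
  simp only [map_smul, smul_eq_mul, hΛ.map_orbitSum, hΛ.map_one] at h3
  have h4 : Λ ψ * (q * q) ≤ (C * (Λ' ψ + 2 * η)) * (q * q) := by linarith
  have h5 := le_of_mul_le_mul_right h4 (by positivity)
  have h6 : C * (2 * η) = ε := by rw [hη]; field_simp
  linarith

theorem IsConformal.eq (hB : ∃ᶠ q in atTop, IsReturnTime b q ∧ OscBound b g q B)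
    (hmean : ∫ x, g x = 0) (hΛ : IsConformal b g Λ) (hΛ' : IsConformal b g Λ') : Λ = Λ' := by
  -- The extra `1` makes `c = C⁻¹` strictly less than `1`.
  set C := Real.exp (6 * B) + 1 with hC
  have hC1 : 1 < C := by linarith [Real.exp_pos (6 * B)]
  set c := C⁻¹ with hc
  have hc0 : 0 < c := by positivity
  have hc1 : c < 1 := inv_lt_one_of_one_lt₀ hC1
  have hcle : ∀ {Λ Λ' : C(UnitAddCircle, ℝ) →ₗ[ℝ] ℝ}, IsConformal b g Λ → IsConformal b g Λ' →
      ∀ {ψ : C(UnitAddCircle, ℝ)}, (∀ x, 0 ≤ ψ x) → c * Λ' ψ ≤ Λ ψ := by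
    intro Λ Λ' hΛ hΛ' ψ hψ
    rw [hc, inv_mul_le_iff₀ (by positivity)]
    have := IsConformal.le_exp_mul hB hmean hΛ' hΛ hψ
    have := hΛ.nonneg ψ hψ
    rw [hC]
    linarith
  have hpow : ∀ (n : ℕ) {Λ Λ' : C(UnitAddCircle, ℝ) →ₗ[ℝ] ℝ}, IsConformal b g Λ →
      IsConformal b g Λ' → ∀ {ψ : C(UnitAddCircle, ℝ)}, (∀ x, 0 ≤ ψ x) →
        (1 - (1 - c) ^ n) * Λ' ψ ≤ Λ ψ := by
    intro n
    induction n with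
    | zero => intro Λ Λ' hΛ _ ψ hψ; simpa using hΛ.nonneg ψ hψ
    | succ n ih =>
      intro Λ Λ' hΛ hΛ' ψ hψ
      set r := (1 - c) ^ n with hr
      have hr0 : 0 < r := pow_pos (by linarith) n
      -- The normalized remainder is again conformal, hence itself dominates `c • Λ'`; this shrinks
      -- the defect `r` to `r (1 - c)`.
      have hconf : IsConformal b g (r⁻¹ • (Λ - (1 - r) • Λ')) := by
        refine ⟨fun χ hχ => ?_, ?_, fun χ => ?_⟩
        · have := ih hΛ hΛ' hχ
          simp only [LinearMap.smul_apply, LinearMap.sub_apply, smul_eq_mul]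
          exact mul_nonneg (by positivity) (by linarith)
        · simp [hΛ.map_one, hΛ'.map_one, hr0.ne']
        · simp [hΛ.map_transfer, hΛ'.map_transfer]
      have h1 := hcle hconf hΛ' hψ
      simp only [LinearMap.smul_apply, LinearMap.sub_apply, smul_eq_mul] at h1
      rw [inv_mul_eq_div r, le_div_iff₀ hr0] at h1
      rw [pow_succ, ← hr]
      linarith
  have hle : ∀ {Λ Λ' : C(UnitAddCircle, ℝ) →ₗ[ℝ] ℝ}, IsConformal b g Λ → IsConformal b g Λ' →
      ∀ {ψ : C(UnitAddCircle, ℝ)}, (∀ x, 0 ≤ ψ x) → Λ' ψ ≤ Λ ψ := by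
    intro Λ Λ' hΛ hΛ' ψ hψ
    have hlim : Tendsto (fun n : ℕ => (1 - (1 - c) ^ n) * Λ' ψ) atTop (𝓝 ((1 - 0) * Λ' ψ)) :=
      ((tendsto_pow_atTop_nhds_zero_of_lt_one (by linarith) (by linarith)).const_sub 1).mul_const _
    rw [sub_zero, one_mul] at hlim
    exact le_of_tendsto' hlim fun n => hpow n hΛ hΛ' hψ
  have heq : ∀ ψ : C(UnitAddCircle, ℝ), (∀ x, 0 ≤ ψ x) → Λ ψ = Λ' ψ := fun ψ hψ =>
    le_antisymm (hle hΛ' hΛ hψ) (hle hΛ hΛ' hψ)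
  ext ψ
  have h1 := heq (ψ + ‖ψ‖ • 1) fun x => by
    have := (abs_le.1 (ψ.norm_coe_le_norm x)).1
    simp only [ContinuousMap.add_apply, ContinuousMap.smul_apply, ContinuousMap.one_apply,
      smul_eq_mul, mul_one]
    linarith
  simpa [hΛ.map_one, hΛ'.map_one] using h1

end Conformal

/-! ### Convergence of the orbit averages -/

section Convergence

variable {b : UnitAddCircle} {g : C(UnitAddCircle, ℝ)} {B : ℝ}

theorem frequently_abs_rotationSum_le
    (hB : ∃ᶠ q in atTop, IsReturnTime b q ∧ OscBound b g q B) (hmean : ∫ x, g x = 0) :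
    ∃ᶠ q in atTop, ∀ x, |rotationSum b g q x| ≤ 2 * B := by
  refine hB.mono fun q hq x => ?_
  have := hq.1.abs_rotationSum_sub_integral_le hq.2 g.continuous x
  rwa [hmean, mul_zero, sub_zero] at this

/-- This makes both boundary terms of `orbitSum_transfer_one` negligible. Each time `j` with `|S_j|
≤ D` supplies a term at least `exp(-D)` at index `j`, and one at least `exp(-D) exp(S_n)` at index
`n - j`. -/
theorem eventually_le_orbitSum_one {D : ℝ}
    (hD : ∃ᶠ q in atTop, ∀ x, |rotationSum b g q x| ≤ D) (R : ℝ) :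
    ∀ᶠ n in atTop, ∀ x, R ≤ orbitSum b g n 1 x ∧
      R * Real.exp (rotationSum b g n x) ≤ orbitSum b g n 1 x := by
  obtain ⟨m, hm⟩ := exists_nat_ge (R * Real.exp D)
  rw [Nat.frequently_atTop_iff_infinite] at hD
  -- The time `0` is excluded so that the reflected index `n - j` is still below `n`.
  obtain ⟨Q, hQ, hQm⟩ := (hD.sdiff (Set.finite_singleton 0)).exists_subset_card_eq m
  have hR : R ≤ ∑ _j ∈ Q, Real.exp (-D) := by
    rw [sum_const, hQm, nsmul_eq_mul, Real.exp_neg, ← div_eq_mul_inv,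
      le_div_iff₀ (Real.exp_pos D)]
    exact hm
  have hQD : ∀ j ∈ Q, ∀ x, |rotationSum b g j x| ≤ D := fun j hj => (hQ hj).1
  have hQ0 : ∀ j ∈ Q, 0 < j := fun j hj => Nat.pos_of_ne_zero fun h => (hQ hj).2 h
  filter_upwards [eventually_gt_atTop (Q.sup id)] with n hn x
  have hQn : ∀ j ∈ Q, j < n := fun j hj => (le_sup (f := id) hj).trans_lt hn
  rw [orbitSum_one_apply]
  constructor
  · refine hR.trans ?_
    calc ∑ _j ∈ Q, Real.exp (-D) ≤ ∑ j ∈ Q, Real.exp (rotationSum b g j x) :=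
          sum_le_sum fun j hj => Real.exp_le_exp.2 (abs_le.1 (hQD j hj x)).1
      _ ≤ _ := sum_le_sum_of_subset_of_nonneg (fun j hj => mem_range.2 (hQn j hj))
          fun _ _ _ => (Real.exp_pos _).le
  · have hinj : Set.InjOn (fun j => n - j) (Q : Set ℕ) := by
      intro i hi j hj hij
      have := hQn i hi
      have := hQn j hj
      simp only at hij
      omega
    calc R * Real.exp (rotationSum b g n x)
        ≤ (∑ _j ∈ Q, Real.exp (-D)) * Real.exp (rotationSum b g n x) := by gcongr
      _ ≤ ∑ j ∈ Q, Real.exp (rotationSum b g (n - j) x) := by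
          rw [sum_mul]
          refine sum_le_sum fun j hj => ?_
          rw [← Real.exp_add]
          refine Real.exp_le_exp.2 ?_
          have h1 := rotationSum_add (b := b) (g := g) (n - j) j x
          rw [Nat.sub_add_cancel (hQn j hj).le] at h1
          linarith [(abs_le.1 (hQD j hj (x + (n - j) • b))).2]
      _ = ∑ i ∈ Q.image (fun j => n - j), Real.exp (rotationSum b g i x) :=
          (sum_image (f := fun i => Real.exp (rotationSum b g i x)) hinj).symm
      _ ≤ _ := by
          refine sum_le_sum_of_subset_of_nonneg (fun i hi => ?_) fun _ _ _ => (Real.exp_pos _).le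
          obtain ⟨j, hj, rfl⟩ := mem_image.1 hi
          have := hQ0 j hj
          have := hQn j hj
          exact mem_range.2 (by omega)

theorem abs_orbitSum_le (n : ℕ) (ψ : C(UnitAddCircle, ℝ)) (x : UnitAddCircle) :
    |orbitSum b g n ψ x| ≤ ‖ψ‖ * orbitSum b g n 1 x := by
  rw [orbitSum_apply, orbitSum_one_apply, mul_sum]
  refine (abs_sum_le_sum_abs _ _).trans (sum_le_sum fun j _ => ?_)
  rw [abs_mul, abs_of_pos (Real.exp_pos _), mul_comm]
  gcongr
  exact ψ.norm_coe_le_norm _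

/-- The averages of each `ψ` lie in a compact interval, so they converge along an ultrafilter. The
defect of conformality is the boundary term divided by the total weight, and tends to `0`. -/
theorem exists_isConformal_tendsto
    (hB : ∃ᶠ q in atTop, IsReturnTime b q ∧ OscBound b g q B) (hmean : ∫ x, g x = 0)
    (U : Ultrafilter ℕ) (hU : (U : Filter ℕ) ≤ atTop) (x : ℕ → UnitAddCircle) :
    ∃ Λ, IsConformal b g Λ ∧
      ∀ ψ, Tendsto (fun n => orbitSum b g n ψ (x n) / orbitSum b g n 1 (x n)) U (𝓝 (Λ ψ)) := by
  have hbound : ∀ (ψ : C(UnitAddCircle, ℝ)) (n : ℕ),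
      orbitSum b g n ψ (x n) / orbitSum b g n 1 (x n) ∈ Set.Icc (-‖ψ‖) ‖ψ‖ := by
    intro ψ n
    rw [Set.mem_Icc, ← abs_le, abs_div, abs_of_nonneg (orbitSum_one_nonneg n (x n))]
    exact div_le_of_le_mul₀ (orbitSum_one_nonneg _ _) (norm_nonneg _) (abs_orbitSum_le n ψ (x n))
  have hlim : ∀ ψ : C(UnitAddCircle, ℝ), ∃ l : ℝ,
      Tendsto (fun n => orbitSum b g n ψ (x n) / orbitSum b g n 1 (x n)) U (𝓝 l) := by
    intro ψ
    obtain ⟨l, _, hl⟩ := (isCompact_Icc (a := -‖ψ‖) (b := ‖ψ‖)).ultrafilter_le_nhds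
      (U.map fun n => orbitSum b g n ψ (x n) / orbitSum b g n 1 (x n))
      (by
        rw [le_principal_iff, Ultrafilter.mem_coe, Ultrafilter.mem_map]
        exact Filter.univ_mem' (hbound ψ))
    exact ⟨l, hl⟩
  choose L hL using hlim
  refine ⟨⟨⟨L, fun ψ χ => ?_⟩, fun c ψ => ?_⟩, ⟨fun ψ hψ => ?_, ?_, fun ψ => ?_⟩, hL⟩
  · refine tendsto_nhds_unique (hL (ψ + χ)) (((hL ψ).add (hL χ)).congr fun n => ?_)
    rw [map_add, ContinuousMap.add_apply, add_div]
  · refine tendsto_nhds_unique (hL (c • ψ)) (((hL ψ).const_mul c).congr fun n => ?_)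
    rw [map_smul, ContinuousMap.smul_apply, smul_eq_mul, mul_div_assoc]
  · refine ge_of_tendsto' (hL ψ) fun n => div_nonneg ?_ (orbitSum_one_nonneg _ _)
    rw [orbitSum_apply]
    exact sum_nonneg fun _ _ => mul_nonneg (Real.exp_pos _).le (hψ _)
  · refine tendsto_nhds_unique (hL 1) (tendsto_const_nhds.congr' ?_)
    filter_upwards [hU (eventually_gt_atTop 0)] with n hn
    rw [div_self (orbitSum_one_pos hn _).ne']
  · have h0 : Tendsto (fun n => orbitSum b g n (transfer b g 1 ψ) (x n) / orbitSum b g n 1 (x n)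
        - orbitSum b g n ψ (x n) / orbitSum b g n 1 (x n)) U (𝓝 0) := by
      rw [Metric.tendsto_nhds]
      intro ε hε
      set R := 2 * (‖ψ‖ + 1) / ε with hR
      have hψ0 := norm_nonneg ψ
      have hR0 : 0 < R := by positivity
      filter_upwards [hU (eventually_le_orbitSum_one (frequently_abs_rotationSum_le hB hmean) R)]
        with n hn
      obtain ⟨h1, h2⟩ := hn (x n)
      rw [← sub_div, orbitSum_transfer_one, Real.dist_eq, sub_zero, abs_div,
        abs_of_nonneg (orbitSum_one_nonneg n (x n))]
      set W := orbitSum b g n 1 (x n)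
      set E := Real.exp (rotationSum b g n (x n))
      have hE : 0 < E := Real.exp_pos _
      have hW : 0 < W := hR0.trans_le h1
      rw [div_lt_iff₀ hW]
      have h3 : |E * ψ (x n + n • b) - ψ (x n)| ≤ E * ‖ψ‖ + ‖ψ‖ := by
        refine (abs_sub _ _).trans (add_le_add ?_ (ψ.norm_coe_le_norm _))
        rw [abs_mul, abs_of_pos hE]
        gcongr
        exact ψ.norm_coe_le_norm _
      have h4 : ε * R = 2 * (‖ψ‖ + 1) := by rw [hR]; field_simp
      have h5 : 2 * (‖ψ‖ + 1) ≤ ε * W := by rw [← h4]; gcongr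
      have h6 : 2 * (‖ψ‖ + 1) * E ≤ ε * W := by rw [← h4, mul_assoc]; gcongr
      nlinarith
    have h1 := (hL (transfer b g 1 ψ)).sub (hL ψ)
    have := tendsto_nhds_unique h1 h0
    exact sub_eq_zero.1 this

/-- If uniformity failed, an ultrafilter on the bad times, with bad base points, would produce a
conformal functional different from `Λ`. -/
theorem IsConformal.eventually_abs_sub_lt
    (hB : ∃ᶠ q in atTop, IsReturnTime b q ∧ OscBound b g q B) (hmean : ∫ x, g x = 0)
    {Λ : C(UnitAddCircle, ℝ) →ₗ[ℝ] ℝ} (hΛ : IsConformal b g Λ) (ψ : C(UnitAddCircle, ℝ))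
    {ε : ℝ} (hε : 0 < ε) :
    ∀ᶠ n in atTop, ∀ x, |orbitSum b g n ψ x / orbitSum b g n 1 x - Λ ψ| < ε := by
  by_contra hcon
  rw [not_eventually] at hcon
  simp only [not_forall, not_lt] at hcon
  set bad : Set ℕ := {n | ∃ x, ε ≤ |orbitSum b g n ψ x / orbitSum b g n 1 x - Λ ψ|} with hbad
  have hne : (atTop ⊓ 𝓟 bad).NeBot := frequently_mem_iff_neBot.1 hcon
  have hch : ∀ n, ∃ x, n ∈ bad → ε ≤ |orbitSum b g n ψ x / orbitSum b g n 1 x - Λ ψ| := by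
    intro n
    by_cases hn : n ∈ bad
    · obtain ⟨x, hx⟩ := hn
      exact ⟨x, fun _ => hx⟩
    · exact ⟨0, fun h => absurd h hn⟩
  choose x hx using hch
  set U := Ultrafilter.of (atTop ⊓ 𝓟 bad)
  have hU : (U : Filter ℕ) ≤ atTop ⊓ 𝓟 bad := Ultrafilter.of_le _
  obtain ⟨Λ', hΛ', hlim⟩ :=
    exists_isConformal_tendsto hB hmean U (hU.trans inf_le_left) x
  have heq := IsConformal.eq hB hmean hΛ' hΛ
  have h1 := (hlim ψ).sub_const (Λ ψ) |>.abs
  rw [heq, sub_self, abs_zero] at h1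
  have h2 : ε ≤ 0 := by
    refine ge_of_tendsto h1 ?_
    have h3 : bad ∈ (U : Filter ℕ) := (hU.trans inf_le_right) (mem_principal_self bad)
    filter_upwards [h3] with n hn using hx n hn
  linarith

end Convergence

/-! ### Stationary measures are conformal -/

theorem jumpRight_pos (f : C(UnitAddCircle, ℝ)) (x : UnitAddCircle) : 0 < jumpRight f x := by
  unfold jumpRight
  positivity

theorem jumpLeft_eq (f : C(UnitAddCircle, ℝ)) (x : UnitAddCircle) :
    jumpLeft f x = 1 / (1 + Real.exp (f x)) := by
  have : 0 < 1 + Real.exp (f x) := by positivity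
  unfold jumpLeft jumpRight
  field_simp
  ring

theorem jumpLeft_pos (f : C(UnitAddCircle, ℝ)) (x : UnitAddCircle) : 0 < jumpLeft f x := by
  rw [jumpLeft_eq]
  positivity

theorem jumpLeft_mul_exp (f : C(UnitAddCircle, ℝ)) (x : UnitAddCircle) :
    jumpLeft f x * Real.exp (f x) = jumpRight f x := by
  rw [jumpLeft_eq, jumpRight]
  ring

theorem jumpRight_add_jumpLeft (f : C(UnitAddCircle, ℝ)) (x : UnitAddCircle) :
    jumpRight f x + jumpLeft f x = 1 := by
  rw [jumpLeft]
  ring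

theorem continuous_jumpRight (f : C(UnitAddCircle, ℝ)) : Continuous (jumpRight f) := by
  have hf : Continuous fun x => Real.exp (f x) := Real.continuous_exp.comp f.continuous
  exact hf.div (continuous_const.add hf) fun x => by positivity

theorem continuous_jumpLeft (f : C(UnitAddCircle, ℝ)) : Continuous (jumpLeft f) :=
  continuous_const.sub (continuous_jumpRight f)

theorem IsStationary.integral_eq {f : C(UnitAddCircle, ℝ)} {α : ℝ} {μ : Measure UnitAddCircle}
    (hμ : IsStationary f α μ) {φ : UnitAddCircle → ℝ} (hφ : Continuous φ) :
    ∫ x, φ x ∂μ = ∫ x, (jumpRight f x * φ (x + (α : UnitAddCircle))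
      + jumpLeft f x * φ (x - (α : UnitAddCircle))) ∂μ := by
  have := hμ.1
  have h1 : (circleKernel f α ∘ₖ Kernel.const Unit μ) () = μ := by
    rw [Kernel.comp_apply, Kernel.const_apply]
    exact hμ.2
  have h2 := Kernel.integral_comp (η := circleKernel f α) (κ := Kernel.const Unit μ) (a := ())
    (f := φ) (by rw [h1]; exact integrable_of_continuous hφ)
  rw [h1, Kernel.const_apply] at h2
  rw [h2]
  congr 1
  ext x
  have hk : circleKernel f α x =
      ENNReal.ofReal (jumpRight f x) • Measure.dirac (x + (α : UnitAddCircle)) +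
      ENNReal.ofReal (jumpLeft f x) • Measure.dirac (x - (α : UnitAddCircle)) := rfl
  rw [hk, integral_add_measure
      ((integrable_of_continuous hφ).smul_measure ENNReal.ofReal_ne_top)
      ((integrable_of_continuous hφ).smul_measure ENNReal.ofReal_ne_top),
    integral_smul_measure, integral_smul_measure, integral_dirac, integral_dirac,
    ENNReal.toReal_ofReal (jumpRight_nonneg f x), ENNReal.toReal_ofReal (jumpLeft_nonneg f x)]
  rfl

/-- The functional `ψ ↦ ∫ q ψ dμ`. -/
def leftFunctional (f : C(UnitAddCircle, ℝ)) (μ : Measure UnitAddCircle) [IsFiniteMeasure μ] :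
    C(UnitAddCircle, ℝ) →ₗ[ℝ] ℝ where
  toFun ψ := ∫ x, jumpLeft f x * ψ x ∂μ
  map_add' ψ χ := by
    simp only [ContinuousMap.add_apply, mul_add]
    exact integral_add (integrable_of_continuous ((continuous_jumpLeft f).mul ψ.continuous))
      (integrable_of_continuous ((continuous_jumpLeft f).mul χ.continuous))
  map_smul' c ψ := by
    simp only [ContinuousMap.smul_apply, smul_eq_mul, RingHom.id_apply]
    rw [← integral_const_mul]
    congr 1
    ext x
    ring

section Flux

variable {f : C(UnitAddCircle, ℝ)} {μ : Measure UnitAddCircle} [IsFiniteMeasure μ] {α : ℝ}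

theorem leftFunctional_apply (ψ : C(UnitAddCircle, ℝ)) :
    leftFunctional f μ ψ = ∫ x, jumpLeft f x * ψ x ∂μ := rfl

theorem leftFunctional_transfer (ψ : C(UnitAddCircle, ℝ)) (b : UnitAddCircle) :
    leftFunctional f μ (transfer b f 1 ψ) = ∫ x, jumpRight f x * ψ (x + b) ∂μ := by
  rw [leftFunctional_apply]
  congr 1
  ext x
  rw [transfer_apply, one_smul, ← jumpLeft_mul_exp]
  simp [rotationSum, mul_assoc]

theorem leftFunctional_mono {ψ χ : C(UnitAddCircle, ℝ)} (h : ∀ x, ψ x ≤ χ x) :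
    leftFunctional f μ ψ ≤ leftFunctional f μ χ :=
  integral_mono (integrable_of_continuous ((continuous_jumpLeft f).mul ψ.continuous))
    (integrable_of_continuous ((continuous_jumpLeft f).mul χ.continuous))
    fun x => mul_le_mul_of_nonneg_left (h x) (jumpLeft_nonneg f x)

/-- The net flux `ψ ↦ ∫ p ψ(· + b) - q ψ dμ`. -/
def flux (b : UnitAddCircle) (f : C(UnitAddCircle, ℝ)) (μ : Measure UnitAddCircle)
    [IsFiniteMeasure μ] : C(UnitAddCircle, ℝ) →ₗ[ℝ] ℝ :=
  leftFunctional f μ ∘ₗ transfer b f 1 - leftFunctional f μ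

theorem flux_apply (b : UnitAddCircle) (ψ : C(UnitAddCircle, ℝ)) :
    flux b f μ ψ = leftFunctional f μ (transfer b f 1 ψ) - leftFunctional f μ ψ := rfl

theorem flux_eq_integral (b : UnitAddCircle) (ψ : C(UnitAddCircle, ℝ)) :
    flux b f μ ψ = ∫ x, (jumpRight f x * ψ (x + b) - jumpLeft f x * ψ x) ∂μ := by
  rw [flux_apply, leftFunctional_transfer, leftFunctional_apply, ← integral_sub]
  · exact integrable_of_continuous
      ((continuous_jumpRight f).mul (ψ.continuous.comp (continuous_add_const _)))
  · exact integrable_of_continuous ((continuous_jumpLeft f).mul ψ.continuous)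

theorem abs_flux_le [IsProbabilityMeasure μ] (b : UnitAddCircle) {ψ : C(UnitAddCircle, ℝ)} {D : ℝ}
    (hD : ∀ x, |ψ x| ≤ D) : |flux b f μ ψ| ≤ D := by
  rw [flux_eq_integral]
  have h : ∀ x, ‖jumpRight f x * ψ (x + b) - jumpLeft f x * ψ x‖ ≤ D := by
    intro x
    have h1 := abs_le.1 (hD x)
    have h2 := abs_le.1 (hD (x + b))
    have h3 := jumpRight_nonneg f x
    have h4 := jumpLeft_nonneg f x
    have h5 := jumpRight_add_jumpLeft f x
    have h6 : D = jumpRight f x * D + jumpLeft f x * D := by rw [← add_mul, h5, one_mul]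
    rw [Real.norm_eq_abs, abs_le]
    constructor <;> nlinarith
  simpa using norm_integral_le_of_norm_le_const (μ := μ) (ae_of_all _ h)

/-- The rotated function `ψ(· + c)`. -/
def rotate (c : UnitAddCircle) (ψ : C(UnitAddCircle, ℝ)) : C(UnitAddCircle, ℝ) :=
  ⟨fun x => ψ (x + c), ψ.continuous.comp (continuous_add_const _)⟩

theorem rotate_apply (c : UnitAddCircle) (ψ : C(UnitAddCircle, ℝ)) (x : UnitAddCircle) :
    rotate c ψ x = ψ (x + c) := rfl

/-- The difference of the two sides is the stationarity equation tested on `ψ(· + α)`. -/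
theorem IsStationary.flux_rotate (hμ : IsStationary f α μ) (ψ : C(UnitAddCircle, ℝ)) :
    flux (α : UnitAddCircle) f μ (rotate (α : UnitAddCircle) ψ)
      = flux (α : UnitAddCircle) f μ ψ := by
  have h1 := hμ.integral_eq (rotate (α : UnitAddCircle) ψ).continuous
  simp only [rotate_apply, sub_add_cancel] at h1
  set a := (α : UnitAddCircle)
  have hp := continuous_jumpRight f
  have hq := continuous_jumpLeft f
  have hc : ∀ c : UnitAddCircle, Continuous fun x => ψ (x + c) := fun c =>
    ψ.continuous.comp (continuous_add_const _)
  rw [← sub_eq_zero, flux_eq_integral, flux_eq_integral]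
  simp only [rotate_apply]
  rw [← integral_sub]
  · rw [← sub_eq_zero, ← integral_sub] at h1
    · rw [← neg_eq_zero, ← h1, ← integral_neg]
      congr 1
      ext x
      have h5 := jumpRight_add_jumpLeft f x
      linear_combination ψ (x + a) * h5
    · exact integrable_of_continuous (hc a)
    · exact integrable_of_continuous
        ((hp.mul ((hc a).comp (continuous_add_const a))).add (hq.mul ψ.continuous))
  · exact integrable_of_continuous ((hp.mul ((hc a).comp (continuous_add_const a))).sub
      (hq.mul (hc a)))
  · exact integrable_of_continuous ((hp.mul (hc a)).sub (hq.mul ψ.continuous))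

/-- The flux is bounded and rotation invariant, and the averages of `ψ` over orbits of return length
are uniformly close to `∫ ψ`. -/
theorem IsStationary.flux_eq (hμ : IsStationary f α μ)
    (hret : ∃ᶠ q in atTop, IsReturnTime (α : UnitAddCircle) q) (ψ : C(UnitAddCircle, ℝ)) :
    flux (α : UnitAddCircle) f μ ψ
      = (∫ x, ψ x) * flux (α : UnitAddCircle) f μ 1 := by
  have := hμ.1
  set a := (α : UnitAddCircle)
  have hrot : ∀ i : ℕ, flux a f μ (rotate (i • a) ψ) = flux a f μ ψ := by
    intro i
    induction i with
    | zero =>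
      congr 1
      ext x
      simp [rotate_apply]
    | succ i ih =>
      rw [← ih, ← hμ.flux_rotate (rotate (i • a) ψ)]
      congr 1
      ext x
      simp only [rotate_apply]
      congr 1
      rw [add_assoc, succ_nsmul']
  rw [← sub_eq_zero, ← abs_nonpos_iff]
  refine le_of_forall_pos_le_add fun ε hε => ?_
  rw [zero_add]
  obtain ⟨q, hq, hqη⟩ := (hret.and_eventually
    (eventually_abs_add_sub_le ψ.continuous (half_pos hε))).exists
  have hq0 : (0 : ℝ) < q := by exact_mod_cast hq.pos
  -- `ψ` is only continuous, so the oscillation bound comes from uniform continuity; it is `o(q)`,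
  -- which suffices.
  have hosc : OscBound a ψ q (q * (ε / 2)) := by
    intro x u hu
    refine (sum_le_sum fun j _ => hqη (x + j • a) (u j) (hu j)).trans (le_of_eq ?_)
    simp
  have h1 := abs_flux_le (f := f) (μ := μ) a
    (ψ := (∑ i ∈ range q, rotate (i • a) ψ) - (q * ∫ y, ψ y) • 1) (D := 2 * (q * (ε / 2)))
    (fun x => by
      have := hq.abs_rotationSum_sub_integral_le hosc ψ.continuous x
      simpa [ContinuousMap.sum_apply, rotate_apply, rotationSum] using this)
  simp only [map_sub, map_sum, hrot, sum_const, card_range, map_smul, nsmul_eq_mul,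
    smul_eq_mul] at h1
  have h2 : (q : ℝ) * flux a f μ ψ - q * (∫ y, ψ y) * flux a f μ 1
      = q * (flux a f μ ψ - (∫ y, ψ y) * flux a f μ 1) := by ring
  rw [h2, abs_mul, Nat.abs_cast] at h1
  have h3 : 2 * ((q : ℝ) * (ε / 2)) = q * ε := by ring
  rw [h3] at h1
  exact le_of_mul_le_mul_left h1 hq0

theorem IsStationary.flux_eq_zero (hμ : IsStationary f α μ) {B : ℝ}
    (hB : ∃ᶠ q in atTop, IsReturnTime (α : UnitAddCircle) q ∧ OscBound (α : UnitAddCircle) f q B)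
    (hmean : ∫ x, f x = 0) (ψ : C(UnitAddCircle, ℝ)) : flux (α : UnitAddCircle) f μ ψ = 0 := by
  have hret := hB.mono fun q hq => hq.1
  rw [hμ.flux_eq hret]
  set a := (α : UnitAddCircle)
  set c := flux a f μ 1
  suffices hc : c = 0 by rw [hc, mul_zero]
  set J : ℕ → ℝ := fun j => ∫ x, transfer a f j 1 x with hJ
  -- From `exp s ≥ 1 + s` and the mean zero of `S_j f`.
  have hJ1 : ∀ j, 1 ≤ J j := by
    intro j
    have h1 : ∫ x : UnitAddCircle, (1 + rotationSum a f j x) = 1 := by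
      rw [integral_add (integrable_const _)
        (integrable_of_continuous (continuous_rotationSum f.continuous j)),
        integral_rotationSum f.continuous, hmean]
      simp
    rw [← h1]
    refine integral_mono (integrable_of_continuous
      (continuous_const.add (continuous_rotationSum f.continuous j)))
      (integrable_of_continuous (transfer a f j 1).continuous) fun x => ?_
    simp only [transfer_apply, ContinuousMap.one_apply, mul_one]
    linarith [Real.add_one_le_exp (rotationSum a f j x)]
  have hsum : ∀ n : ℕ, leftFunctional f μ (transfer a f n 1)
      = leftFunctional f μ (transfer a f 0 1) + (∑ j ∈ range n, J j) * c := by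
    intro n
    induction n with
    | zero => simp
    | succ n ih =>
      have h1 := hμ.flux_eq hret (transfer a f n 1)
      rw [flux_apply, transfer_one_transfer] at h1
      rw [sum_range_succ, add_mul, ← add_assoc, ← ih]
      linarith
  set l := leftFunctional f μ 1
  have h0 : leftFunctional f μ (transfer a f 0 1) = l := by
    congr 1
    ext x
    simp [transfer_apply]
  have hl0 : ∀ χ : C(UnitAddCircle, ℝ), (∀ x, 0 ≤ χ x) → 0 ≤ leftFunctional f μ χ := by
    intro χ hχ
    have := leftFunctional_mono (f := f) (μ := μ) (ψ := 0) (χ := χ) hχ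
    rwa [map_zero] at this
  by_contra hc
  obtain ⟨N, hN⟩ := exists_nat_gt ((Real.exp (2 * B) * l + l) / |c|)
  obtain ⟨n, hn, hNn⟩ := ((frequently_abs_rotationSum_le hB hmean).and_eventually
    (eventually_ge_atTop N)).exists
  have h1 : leftFunctional f μ (transfer a f n 1) ≤ Real.exp (2 * B) * l := by
    have := leftFunctional_mono (f := f) (μ := μ) (ψ := transfer a f n 1)
      (χ := Real.exp (2 * B) • 1) (fun x => by
        simp only [transfer_apply, ContinuousMap.one_apply, mul_one, ContinuousMap.smul_apply,
          smul_eq_mul]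
        exact Real.exp_le_exp.2 (abs_le.1 (hn x)).2)
    rwa [map_smul, smul_eq_mul] at this
  have h2 : 0 ≤ leftFunctional f μ (transfer a f n 1) := hl0 _ fun x => by
    simp only [transfer_apply, ContinuousMap.one_apply, mul_one]
    exact (Real.exp_pos _).le
  have h3 : 0 ≤ l := hl0 _ fun x => by simp
  have h4 : (N : ℝ) ≤ ∑ j ∈ range n, J j := by
    calc (N : ℝ) ≤ n := by exact_mod_cast hNn
      _ = ∑ j ∈ range n, (1 : ℝ) := by simp
      _ ≤ _ := sum_le_sum fun j _ => hJ1 j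
  have h5 : |(∑ j ∈ range n, J j) * c| ≤ Real.exp (2 * B) * l + l := by
    have h6 := hsum n
    rw [h0] at h6
    have h7 : 0 ≤ Real.exp (2 * B) * l := by positivity
    rw [abs_le]
    constructor <;> linarith
  have hc' : 0 < |c| := abs_pos.2 hc
  rw [div_lt_iff₀ hc'] at hN
  rw [abs_mul, abs_of_nonneg ((Nat.cast_nonneg N).trans h4)] at h5
  nlinarith

/-- The Birkhoff sum of length two. -/
def doubleSum (a : UnitAddCircle) (f : C(UnitAddCircle, ℝ)) : C(UnitAddCircle, ℝ) := f + rotate a f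

theorem rotationSum_doubleSum (a : UnitAddCircle) (n : ℕ) (x : UnitAddCircle) :
    rotationSum (2 • a) (doubleSum a f) n x = rotationSum a f (2 * n) x := by
  induction n with
  | zero => simp
  | succ n ih =>
    rw [rotationSum_succ, ih, mul_add, mul_one, rotationSum_succ, rotationSum_succ, doubleSum,
      ContinuousMap.add_apply, rotate_apply, ← mul_smul, mul_comm n 2, add_assoc x,
      ← succ_nsmul, add_assoc]

theorem transfer_doubleSum (a : UnitAddCircle) (ψ : C(UnitAddCircle, ℝ)) :
    transfer (2 • a) (doubleSum a f) 1 ψ = transfer a f 1 (transfer a f 1 ψ) := by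
  rw [transfer_one_transfer]
  ext x
  rw [transfer_apply, transfer_apply, rotationSum_doubleSum, one_smul]

theorem IsStationary.isConformal (hμ : IsStationary f α μ) {B : ℝ}
    (hB : ∃ᶠ q in atTop, IsReturnTime (α : UnitAddCircle) q ∧ OscBound (α : UnitAddCircle) f q B)
    (hmean : ∫ x, f x = 0) :
    0 < leftFunctional f μ 1 ∧
      IsConformal (2 • (α : UnitAddCircle)) (doubleSum (α : UnitAddCircle) f)
        ((leftFunctional f μ 1)⁻¹ • leftFunctional f μ) := by
  have := hμ.1
  have hl : 0 < leftFunctional f μ 1 := by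
    rw [leftFunctional_apply]
    simp only [ContinuousMap.one_apply, mul_one]
    rw [integral_pos_iff_support_of_nonneg (fun x => jumpLeft_nonneg f x)
      (integrable_of_continuous (continuous_jumpLeft f))]
    have : Function.support (jumpLeft f) = Set.univ :=
      Set.eq_univ_of_forall fun x => (jumpLeft_pos f x).ne'
    simp [this]
  have hmap : ∀ ψ, leftFunctional f μ (transfer (α : UnitAddCircle) f 1 ψ)
      = leftFunctional f μ ψ := fun ψ => sub_eq_zero.1 (hμ.flux_eq_zero hB hmean ψ)
  refine ⟨hl, fun ψ hψ => ?_, ?_, fun ψ => ?_⟩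
  · have := leftFunctional_mono (f := f) (μ := μ) (ψ := 0) (χ := ψ) hψ
    rw [map_zero] at this
    exact mul_nonneg (by positivity) this
  · simp [hl.ne']
  · rw [transfer_doubleSum, LinearMap.smul_apply, LinearMap.smul_apply, hmap, hmap]

end Flux

/-! ### Expected visits during an excursion -/

/-- The recurrence criterion for a birth-death chain. The net current `e` of `d` is constant, so `d
/ π` increases by `e` times the resistance `(π k * p k)⁻¹`. As `d / π ≤ 1` and the resistances do
not tend to zero, `e = 0`. -/
theorem eq_zero_of_harmonic {p q π d : ℕ → ℝ} (hq : ∀ k, 0 < q k) (hp : ∀ k, 0 < p k)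
    (hpq : ∀ k, p k + q k = 1)
    (hπ : ∀ k, 0 < π k) (hbal : ∀ k, π k * p k = π (k + 1) * q (k + 1)) {M : ℝ}
    (hM : ∃ᶠ k in atTop, π k * p k ≤ M) (hd : ∀ k, 0 ≤ d k) (hdπ : ∀ k, d k ≤ π k)
    (hd0 : d 0 = 0) (hrec : ∀ k, d (k + 1) = d k * p k + d (k + 2) * q (k + 2)) (k : ℕ) :
    d k = 0 := by
  set e := d 1 * q 1 with he
  have hflux : ∀ k, d (k + 1) * q (k + 1) - d k * p k = e := by
    intro k
    induction k with
    | zero => simp [hd0, he]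
    | succ k ih =>
      rw [← ih]
      linear_combination -hrec k - d (k + 1) * hpq (k + 1)
  have hC : ∀ k, 0 < π k * p k := fun k => mul_pos (hπ k) (hp k)
  have hr : ∀ k, d (k + 1) / π (k + 1) - d k / π k = e * (π k * p k)⁻¹ := by
    intro k
    have h1 : d (k + 1) / π (k + 1) = d (k + 1) * q (k + 1) * (π k * p k)⁻¹ := by
      rw [hbal k]
      have := (hπ (k + 1)).ne'
      have := (hq (k + 1)).ne'
      field_simp
    have h2 : d k / π k = d k * p k * (π k * p k)⁻¹ := by
      have := (hπ k).ne'
      have := (hp k).ne'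
      field_simp
    rw [h1, h2, ← sub_mul, hflux]
  have hsum : ∀ n, ∑ k ∈ range n, e * (π k * p k)⁻¹ = d n / π n := by
    intro n
    simp_rw [← hr]
    rw [sum_range_sub (fun k => d k / π k), hd0, zero_div, sub_zero]
  have he0 : 0 ≤ e := mul_nonneg (hd 1) (hq 1).le
  have hsummable : Summable fun k => e * (π k * p k)⁻¹ :=
    summable_of_sum_range_le (c := 1)
      (fun k => mul_nonneg he0 (inv_nonneg.2 (hC k).le)) fun n => by
        rw [hsum, div_le_one (hπ n)]
        exact hdπ n
  have hez : e = 0 := by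
    by_contra hne
    have hepos : 0 < e := lt_of_le_of_ne he0 (Ne.symm hne)
    have hMpos : 0 < M := by
      obtain ⟨k, hk⟩ := hM.exists
      exact (hC k).trans_le hk
    have := hsummable.tendsto_atTop_zero.eventually (gt_mem_nhds (show 0 < e * M⁻¹ by positivity))
    obtain ⟨k, hk, hk'⟩ := (hM.and_eventually this).exists
    have h3 : M⁻¹ ≤ (π k * p k)⁻¹ := inv_anti₀ (hC k) hk
    have h4 := mul_le_mul_of_nonneg_left h3 he0
    linarith
  have h1 := hsum k
  rw [hez] at h1
  simp only [zero_mul, sum_const_zero] at h1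
  rcases div_eq_zero_iff.1 h1.symm with h | h
  · exact h
  · exact absurd h (hπ k).ne'

section Walk

variable {f : C(UnitAddCircle, ℝ)} {α : ℝ} {x : UnitAddCircle}

instance : IsProbabilityMeasure (walkLaw f α x) := by
  unfold walkLaw
  infer_instance

theorem walkKernel_singleton (k a : ℤ) :
    walkKernel f α x k {a} = ENNReal.ofReal (jumpRight f (orbitPoint α x k)) *
        (if k = a - 1 then 1 else 0) +
      ENNReal.ofReal (jumpLeft f (orbitPoint α x k)) * (if k = a + 1 then 1 else 0) := by
  have h : walkKernel f α x k =
      ENNReal.ofReal (jumpRight f (orbitPoint α x k)) • Measure.dirac (k + 1) +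
      ENNReal.ofReal (jumpLeft f (orbitPoint α x k)) • Measure.dirac (k - 1) := rfl
  rw [h]
  simp only [Measure.coe_add, Measure.coe_smul, Pi.add_apply, Pi.smul_apply, smul_eq_mul,
    Measure.dirac_apply, Set.indicator_apply, Set.mem_singleton_iff, Pi.one_apply,
    ← eq_sub_iff_add_eq, sub_eq_iff_eq_add]

/-- The Markov property at time `n`, for events of the past that fix the present position. -/
theorem walkLaw_inter_succ (n : ℕ) (S : Set ((_ : Finset.Iic n) → ℤ)) (b a : ℤ)
    (hS : ∀ y ∈ S, y ⟨n, Finset.mem_Iic.2 le_rfl⟩ = b) :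
    walkLaw f α x {ω | Preorder.frestrictLe (π := fun _ => ℤ) n ω ∈ S ∧ ω (n + 1) = a}
      = walkLaw f α x {ω | Preorder.frestrictLe (π := fun _ => ℤ) n ω ∈ S}
        * walkKernel f α x b {a} := by
  have hmeas : Measurable (Preorder.frestrictLe (π := fun _ : ℕ => ℤ) n) :=
    Preorder.measurable_frestrictLe n
  have hSm : MeasurableSet S := MeasurableSet.of_discrete
  have h1 := Kernel.map_frestrictLe_trajMeasure_compProd_eq_map_trajMeasure
    (X := fun _ => ℤ) (μ₀ := Measure.dirac (0 : ℤ)) (κ := historyKernel f α x) (a := n)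
  have h2 := congrArg (fun m => m (S ×ˢ {a})) h1
  rw [Measure.compProd_apply_prod hSm (measurableSet_singleton a),
    Measure.map_apply (by fun_prop) (hSm.prod (measurableSet_singleton a))] at h2
  have h3 : ∫⁻ y in S, historyKernel f α x n y {a}
      ∂((Kernel.trajMeasure (X := fun _ => ℤ) (Measure.dirac (0 : ℤ)) (historyKernel f α x)).map
        (Preorder.frestrictLe n))
      = ∫⁻ y in S, walkKernel f α x b {a}
      ∂((Kernel.trajMeasure (X := fun _ => ℤ) (Measure.dirac (0 : ℤ)) (historyKernel f α x)).map
        (Preorder.frestrictLe n)) := by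
    refine setLIntegral_congr_fun hSm fun y hy => ?_
    simp only [historyKernel, Kernel.comap_apply]
    rw [hS y hy]
  rw [h3, setLIntegral_const, Measure.map_apply hmeas hSm, mul_comm] at h2
  exact h2.symm

theorem walkLaw_start : walkLaw f α x {ω | ω 0 = 0} = 1 := by
  have h1 : (walkLaw f α x).map (fun ω => ω 0) = Measure.dirac 0 := by
    have h2 : (fun ω : ℕ → ℤ => ω 0) = (fun y : (_ : Finset.Iic 0) → ℤ =>
        y ⟨0, Finset.mem_Iic.2 le_rfl⟩) ∘ Preorder.frestrictLe (π := fun _ => ℤ) 0 := rfl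
    rw [h2, ← Measure.map_map (by fun_prop) (by fun_prop), walkLaw, Kernel.trajMeasure,
      Measure.map_comp _ _ (by fun_prop), Kernel.traj_map_frestrictLe, Kernel.partialTraj_self,
      Measure.id_comp, Measure.map_map (by fun_prop) (by fun_prop)]
    exact Measure.map_id
  have h3 : {ω : ℕ → ℤ | ω 0 = 0} = (fun ω : ℕ → ℤ => ω 0) ⁻¹' {0} := rfl
  rw [h3, ← Measure.map_apply (by fun_prop) (measurableSet_singleton 0), h1]
  simp

/-- The probability to be at `a` at time `n + 1` without a visit of `0` at the times `1, …, n`. -/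
def tabooProb (f : C(UnitAddCircle, ℝ)) (α : ℝ) (x : UnitAddCircle) (n : ℕ) (a : ℤ) : ℝ≥0∞ :=
  walkLaw f α x {ω | (∀ i : ℕ, 1 ≤ i → i < n + 1 → ω i ≠ 0) ∧ ω (n + 1) = a}

theorem tabooProb_zero (a : ℤ) : tabooProb f α x 0 a = walkKernel f α x 0 {a} := by
  have h := walkLaw_inter_succ (f := f) (α := α) (x := x) 0
    {y | y ⟨0, Finset.mem_Iic.2 le_rfl⟩ = 0} 0 a fun y hy => hy
  have h1 : {ω : ℕ → ℤ | Preorder.frestrictLe (π := fun _ => ℤ) 0 ω ∈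
      {y : (_ : Finset.Iic 0) → ℤ | y ⟨0, Finset.mem_Iic.2 le_rfl⟩ = 0}} = {ω | ω 0 = 0} := rfl
  rw [h1, walkLaw_start, one_mul] at h
  rw [← h, tabooProb]
  have hae : ∀ᵐ ω ∂(walkLaw f α x), ω 0 = 0 := by
    have hm : MeasurableSet {ω : ℕ → ℤ | ω 0 = 0} := measurable_pi_apply 0
      (measurableSet_singleton 0)
    exact (prob_compl_eq_zero_iff hm).2 walkLaw_start
  refine measure_congr ?_
  filter_upwards [hae] with ω hω
  apply propext
  constructor
  · rintro ⟨_, h⟩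
    exact ⟨hω, h⟩
  · rintro ⟨_, h⟩
    exact ⟨fun i h1 h2 => by omega, h⟩

theorem tabooProb_succ (n : ℕ) (a : ℤ) :
    tabooProb f α x (n + 1) a =
      (if a - 1 = 0 then 0 else
        tabooProb f α x n (a - 1) * ENNReal.ofReal (jumpRight f (orbitPoint α x (a - 1)))) +
      (if a + 1 = 0 then 0 else
        tabooProb f α x n (a + 1) * ENNReal.ofReal (jumpLeft f (orbitPoint α x (a + 1)))) := by
  set E : ℤ → Set (ℕ → ℤ) := fun b =>
    {ω | ((∀ i : ℕ, 1 ≤ i → i < n + 1 → ω i ≠ 0) ∧ b ≠ 0 ∧ ω (n + 1) = b) ∧ ω (n + 1 + 1) = a}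
    with hE
  have hunion : {ω : ℕ → ℤ | (∀ i : ℕ, 1 ≤ i → i < n + 1 + 1 → ω i ≠ 0) ∧ ω (n + 1 + 1) = a}
      = ⋃ b, E b := by
    ext ω
    simp only [hE, Set.mem_ofPred_eq, Set.mem_iUnion]
    constructor
    · rintro ⟨h1, h2⟩
      exact ⟨ω (n + 1), ⟨fun i hi hi' => h1 i hi (by omega), h1 _ (by omega) (by omega), rfl⟩, h2⟩
    · rintro ⟨b, ⟨h1, h2, h3⟩, h4⟩
      refine ⟨fun i hi hi' => ?_, h4⟩
      rcases Nat.lt_succ_iff_lt_or_eq.1 hi' with h | h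
      · exact h1 i hi h
      · rw [h, h3]; exact h2
  have hterm : ∀ b, E b = {ω | Preorder.frestrictLe (π := fun _ => ℤ) (n + 1) ω ∈
        {y : (_ : Finset.Iic (n + 1)) → ℤ |
          (∀ i (h : i < n + 1), 1 ≤ i → y ⟨i, Finset.mem_Iic.2 h.le⟩ ≠ 0) ∧ b ≠ 0 ∧
            y ⟨n + 1, Finset.mem_Iic.2 le_rfl⟩ = b} ∧ ω (n + 1 + 1) = a} := by
    intro b
    ext ω
    simp only [hE, Set.mem_ofPred_eq, Preorder.frestrictLe_apply]
    tauto
  have hmeas : ∀ b, MeasurableSet (E b) := by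
    intro b
    rw [hterm b]
    generalize {y : (_ : Finset.Iic (n + 1)) → ℤ | _} = S
    have hm : MeasurableSet {ω : ℕ → ℤ | ω (n + 1 + 1) = a} :=
      (measurable_pi_apply (X := fun _ : ℕ => ℤ) (n + 1 + 1)) (measurableSet_singleton a)
    exact ((Preorder.measurable_frestrictLe (X := fun _ : ℕ => ℤ) (n + 1))
      (MeasurableSet.of_discrete (s := S))).inter hm
  have hprob : ∀ b, walkLaw f α x (E b)
      = (if b = 0 then 0 else tabooProb f α x n b) * walkKernel f α x b {a} := by
    intro b
    rw [hterm b, walkLaw_inter_succ (n + 1) _ b a fun y hy => hy.2.2]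
    congr 1
    split_ifs with hb
    · simp [hb]
    · rw [tabooProb]
      congr 1
      ext ω
      simp only [Set.mem_ofPred_eq, Preorder.frestrictLe_apply]
      tauto
  have hdisj : Pairwise (Function.onFun Disjoint E) := by
    intro b c hbc
    rw [Function.onFun, Set.disjoint_left]
    rintro ω ⟨⟨_, _, h1⟩, _⟩ ⟨⟨_, _, h2⟩, _⟩
    exact hbc (h1.symm.trans h2)
  rw [tabooProb, hunion, measure_iUnion hdisj hmeas]
  simp_rw [hprob, walkKernel_singleton, mul_add]
  rw [ENNReal.tsum_add, tsum_eq_single (a - 1), tsum_eq_single (a + 1)]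
  · simp only [if_true, mul_one, ite_mul, zero_mul]
  · intro b hb
    simp [hb]
  · intro b hb
    simp [hb]

theorem excursionWeight_eq (a : ℤ) : excursionWeight f α x a = ∑' n, tabooProb f α x n a := rfl

/-- The summands are the probabilities of the disjoint events that the first return to `0` is at
time `n + 1`. -/
theorem excursionWeight_zero_le : excursionWeight f α x 0 ≤ 1 := by
  have h := tsum_measure_le_measure_univ (μ := walkLaw f α x)
    (s := fun n : ℕ => {ω : ℕ → ℤ | (∀ i : ℕ, 1 ≤ i → i < n + 1 → ω i ≠ 0) ∧ ω (n + 1) = 0})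
    (fun n => by
      have hm : ∀ i : ℕ, MeasurableSet {ω : ℕ → ℤ | ω i = 0} := fun i =>
        measurable_pi_apply i (measurableSet_singleton 0)
      refine MeasurableSet.nullMeasurableSet (MeasurableSet.inter ?_ (hm (n + 1)))
      have : {ω : ℕ → ℤ | ∀ i : ℕ, 1 ≤ i → i < n + 1 → ω i ≠ 0}
          = ⋂ i : ℕ, ⋂ _ : 1 ≤ i, ⋂ _ : i < n + 1, {ω : ℕ → ℤ | ω i = 0}ᶜ := by
        ext ω
        simp
      change MeasurableSet {ω : ℕ → ℤ | ∀ i : ℕ, 1 ≤ i → i < n + 1 → ω i ≠ 0}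
      rw [this]
      exact .iInter fun i => .iInter fun _ => .iInter fun _ => (hm i).compl)
    (fun m n hmn => by
      refine Disjoint.aedisjoint (Set.disjoint_left.2 ?_)
      rintro ω ⟨h1, h2⟩ ⟨h3, h4⟩
      rcases lt_or_gt_of_ne hmn with h | h
      · exact h3 (m + 1) (by omega) (by omega) h2
      · exact h1 (n + 1) (by omega) (by omega) h4)
  rw [measure_univ] at h
  exact h

theorem orbitPoint_natCast (k : ℕ) : orbitPoint α x (k : ℤ) = x + k • (α : UnitAddCircle) := by
  rw [orbitPoint, natCast_zsmul]

/-- The reversible weight `exp(S_k f(x)) q(x) / q(x + k α)`. -/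
def reversibleWeight (f : C(UnitAddCircle, ℝ)) (α : ℝ) (x : UnitAddCircle) (k : ℕ) : ℝ :=
  Real.exp (rotationSum (α : UnitAddCircle) f k x) * jumpLeft f x
    / jumpLeft f (x + k • (α : UnitAddCircle))

theorem reversibleWeight_pos (k : ℕ) : 0 < reversibleWeight f α x k :=
  div_pos (mul_pos (Real.exp_pos _) (jumpLeft_pos f x)) (jumpLeft_pos f _)

theorem reversibleWeight_zero : reversibleWeight f α x 0 = 1 := by
  have := (jumpLeft_pos f x).ne'
  simp [reversibleWeight, this]

theorem reversibleWeight_mul_jumpLeft (k : ℕ) :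
    reversibleWeight f α x k * jumpLeft f (x + k • (α : UnitAddCircle))
      = Real.exp (rotationSum (α : UnitAddCircle) f k x) * jumpLeft f x :=
  div_mul_cancel₀ _ (jumpLeft_pos f _).ne'

theorem reversibleWeight_mul_jumpRight (k : ℕ) :
    reversibleWeight f α x k * jumpRight f (x + k • (α : UnitAddCircle))
      = Real.exp (rotationSum (α : UnitAddCircle) f (k + 1) x) * jumpLeft f x := by
  rw [← jumpLeft_mul_exp, ← mul_assoc, reversibleWeight_mul_jumpLeft, rotationSum_succ,
    Real.exp_add]
  ring

theorem reversibleWeight_rec (k : ℕ) :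
    reversibleWeight f α x (k + 1)
      = reversibleWeight f α x k * jumpRight f (x + k • (α : UnitAddCircle))
        + reversibleWeight f α x (k + 2) * jumpLeft f (x + (k + 2) • (α : UnitAddCircle)) := by
  rw [reversibleWeight_mul_jumpRight, reversibleWeight_mul_jumpLeft,
    ← reversibleWeight_mul_jumpRight (k + 1), ← reversibleWeight_mul_jumpLeft (k + 1), ← mul_add,
    add_comm (jumpLeft _ _), jumpRight_add_jumpLeft, mul_one]

theorem tabooProb_zero_one : tabooProb f α x 0 1 = ENNReal.ofReal (jumpRight f x) := by
  rw [tabooProb_zero, walkKernel_singleton]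
  simp [orbitPoint]

theorem tabooProb_zero_add_two (k : ℕ) : tabooProb f α x 0 ((k + 2 : ℕ) : ℤ) = 0 := by
  rw [tabooProb_zero, walkKernel_singleton, if_neg (by push_cast; omega),
    if_neg (by push_cast; omega)]
  simp

theorem tabooProb_succ_one (n : ℕ) :
    tabooProb f α x (n + 1) ((1 : ℕ) : ℤ) = tabooProb f α x n ((2 : ℕ) : ℤ)
      * ENNReal.ofReal (jumpLeft f (x + 2 • (α : UnitAddCircle))) := by
  rw [tabooProb_succ, if_pos (by simp), if_neg (by simp), zero_add, ← orbitPoint_natCast]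
  rfl

theorem tabooProb_succ_add_two (n k : ℕ) :
    tabooProb f α x (n + 1) ((k + 2 : ℕ) : ℤ)
      = tabooProb f α x n ((k + 1 : ℕ) : ℤ)
          * ENNReal.ofReal (jumpRight f (x + (k + 1) • (α : UnitAddCircle)))
        + tabooProb f α x n ((k + 3 : ℕ) : ℤ)
          * ENNReal.ofReal (jumpLeft f (x + (k + 3) • (α : UnitAddCircle))) := by
  have h1 : ((k + 2 : ℕ) : ℤ) - 1 = ((k + 1 : ℕ) : ℤ) := by push_cast; ring
  have h2 : ((k + 2 : ℕ) : ℤ) + 1 = ((k + 3 : ℕ) : ℤ) := by push_cast; ring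
  rw [tabooProb_succ, h1, h2, if_neg (by omega), if_neg (by omega), orbitPoint_natCast,
    orbitPoint_natCast]

/-- The expected visits are the minimal nonnegative solution of the recursion with source at `0`;
truncating at time `N` gives an induction against the solution `reversibleWeight`. -/
theorem sum_tabooProb_le (N k : ℕ) :
    ∑ n ∈ range N, tabooProb f α x n ((k + 1 : ℕ) : ℤ)
      ≤ ENNReal.ofReal (reversibleWeight f α x (k + 1)) := by
  induction N generalizing k with
  | zero => simp
  | succ N ih =>
    rw [sum_range_succ', reversibleWeight_rec, ENNReal.ofReal_add
      (mul_nonneg (reversibleWeight_pos _).le (jumpRight_nonneg f _))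
      (mul_nonneg (reversibleWeight_pos _).le (jumpLeft_nonneg f _)),
      ENNReal.ofReal_mul (reversibleWeight_pos _).le,
      ENNReal.ofReal_mul (reversibleWeight_pos _).le]
    cases k with
    | zero =>
      simp only [zero_add, tabooProb_succ_one, ← sum_mul]
      rw [add_comm, reversibleWeight_zero, Nat.cast_one, tabooProb_zero_one, zero_smul, add_zero,
        ENNReal.ofReal_one, one_mul]
      gcongr
      exact ih 1
    | succ k =>
      rw [tabooProb_zero_add_two, add_zero]
      simp only [add_assoc, Nat.reduceAdd, tabooProb_succ_add_two, sum_add_distrib, ← sum_mul]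
      gcongr
      · exact ih k
      · exact ih (k + 2)

theorem excursionWeight_le (k : ℕ) :
    excursionWeight f α x ((k + 1 : ℕ) : ℤ) ≤ ENNReal.ofReal (reversibleWeight f α x (k + 1)) :=
  ENNReal.tsum_le_of_sum_range_le fun N => sum_tabooProb_le N k

theorem excursionWeight_one :
    excursionWeight f α x ((1 : ℕ) : ℤ) = ENNReal.ofReal (jumpRight f x)
      + excursionWeight f α x ((2 : ℕ) : ℤ)
        * ENNReal.ofReal (jumpLeft f (x + 2 • (α : UnitAddCircle))) := by
  rw [excursionWeight_eq, tsum_eq_zero_add' ENNReal.summable]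
  simp_rw [tabooProb_succ_one]
  rw [ENNReal.tsum_mul_right, Nat.cast_one, tabooProb_zero_one, excursionWeight_eq]

theorem excursionWeight_add_two (k : ℕ) :
    excursionWeight f α x ((k + 2 : ℕ) : ℤ)
      = excursionWeight f α x ((k + 1 : ℕ) : ℤ)
          * ENNReal.ofReal (jumpRight f (x + (k + 1) • (α : UnitAddCircle)))
        + excursionWeight f α x ((k + 3 : ℕ) : ℤ)
          * ENNReal.ofReal (jumpLeft f (x + (k + 3) • (α : UnitAddCircle))) := by
  rw [excursionWeight_eq, tsum_eq_zero_add' ENNReal.summable, tabooProb_zero_add_two, zero_add]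
  simp_rw [tabooProb_succ_add_two]
  rw [ENNReal.tsum_add, ENNReal.tsum_mul_right, ENNReal.tsum_mul_right, excursionWeight_eq,
    excursionWeight_eq]

theorem excursionWeight_ne_top (k : ℕ) : excursionWeight f α x (k : ℤ) ≠ ⊤ := by
  cases k with
  | zero => exact ne_top_of_le_ne_top ENNReal.one_ne_top excursionWeight_zero_le
  | succ k => exact ne_top_of_le_ne_top ENNReal.ofReal_ne_top (excursionWeight_le k)

/-- The deficit of the visits below the reversible weight solves the homogeneous recursion, so
`eq_zero_of_harmonic` kills it. -/
theorem toReal_excursionWeight {D : ℝ}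
    (hD : ∃ᶠ q in atTop, ∀ x, |rotationSum (α : UnitAddCircle) f q x| ≤ D) (k : ℕ) :
    (excursionWeight f α x ((k + 1 : ℕ) : ℤ)).toReal = reversibleWeight f α x (k + 1) := by
  set G : ℕ → ℝ := fun k => (excursionWeight f α x (k : ℤ)).toReal with hG
  have hG1 : G 1 = jumpRight f x + G 2 * jumpLeft f (x + 2 • (α : UnitAddCircle)) := by
    simp only [hG]
    rw [excursionWeight_one, ENNReal.toReal_add ENNReal.ofReal_ne_top
      (ENNReal.mul_ne_top (excursionWeight_ne_top 2) ENNReal.ofReal_ne_top),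
      ENNReal.toReal_mul, ENNReal.toReal_ofReal (jumpRight_nonneg f _),
      ENNReal.toReal_ofReal (jumpLeft_nonneg f _)]
  have hG2 : ∀ k, G (k + 2) = G (k + 1) * jumpRight f (x + (k + 1) • (α : UnitAddCircle))
      + G (k + 3) * jumpLeft f (x + (k + 3) • (α : UnitAddCircle)) := by
    intro k
    simp only [hG]
    rw [excursionWeight_add_two, ENNReal.toReal_add
      (ENNReal.mul_ne_top (excursionWeight_ne_top _) ENNReal.ofReal_ne_top)
      (ENNReal.mul_ne_top (excursionWeight_ne_top _) ENNReal.ofReal_ne_top),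
      ENNReal.toReal_mul, ENNReal.toReal_mul, ENNReal.toReal_ofReal (jumpRight_nonneg f _),
      ENNReal.toReal_ofReal (jumpLeft_nonneg f _)]
  have hGle : ∀ k, G (k + 1) ≤ reversibleWeight f α x (k + 1) := fun k =>
    ENNReal.toReal_le_of_le_ofReal (reversibleWeight_pos _).le (excursionWeight_le k)
  -- At `0` the value is forced to vanish: the source `p(x)` from the first jump is common to both
  -- solutions and cancels at site `1`.
  set d : ℕ → ℝ := fun k => if k = 0 then 0 else reversibleWeight f α x k - G k with hd
  have hds : ∀ k, d (k + 1) = reversibleWeight f α x (k + 1) - G (k + 1) := fun k => by simp [hd]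
  have hzero := eq_zero_of_harmonic (d := d) (π := reversibleWeight f α x)
    (p := fun k => jumpRight f (x + k • (α : UnitAddCircle)))
    (q := fun k => jumpLeft f (x + k • (α : UnitAddCircle)))
    (M := Real.exp D * jumpLeft f x)
    (fun k => jumpLeft_pos f _) (fun k => jumpRight_pos f _) (fun k => jumpRight_add_jumpLeft f _)
    (fun k => reversibleWeight_pos k)
    (fun k => by rw [reversibleWeight_mul_jumpRight, reversibleWeight_mul_jumpLeft])
    (by
      rw [frequently_atTop] at hD ⊢
      intro N
      obtain ⟨q, hq, hqD⟩ := hD (N + 1)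
      -- The conductance of the edge from `k` to `k + 1` involves `S_{k+1}`, so a time `q` with
      -- bounded sum gives the edge starting at `q - 1`.
      refine ⟨q - 1, by omega, ?_⟩
      rw [reversibleWeight_mul_jumpRight, Nat.sub_add_cancel (by omega)]
      have := jumpLeft_nonneg f x
      gcongr
      exact (abs_le.1 (hqD x)).2)
    (fun k => by
      cases k with
      | zero => simp [hd]
      | succ k => rw [hds]; linarith [hGle k])
    (fun k => by
      cases k with
      | zero => simpa [hd] using (reversibleWeight_pos (f := f) (α := α) (x := x) 0).le
      | succ k =>
        rw [hds]
        linarith [(ENNReal.toReal_nonneg : 0 ≤ G (k + 1))])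
    (by simp [hd])
    (fun k => by
      have h1 := reversibleWeight_rec (f := f) (α := α) (x := x) k
      rw [hds, hds (k + 1)]
      cases k with
      | zero =>
        have h0 : d 0 = 0 := by simp [hd]
        rw [reversibleWeight_zero, zero_smul, add_zero, one_mul] at h1
        rw [h0, zero_mul, zero_add]
        simp only [zero_add, Nat.reduceAdd] at h1 ⊢
        linarith
      | succ k =>
        have h2 := hG2 k
        rw [hds k]
        simp only [add_assoc, Nat.reduceAdd] at h1 h2 ⊢
        linarith)
    (k + 1)
  rw [hds] at hzero
  linarith

end Walk

/-! ### Convergence of the excursion measures -/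

section Excursion

variable {f : C(UnitAddCircle, ℝ)} {α : ℝ} {x : UnitAddCircle}

theorem integral_excursionMeasure_sub (s : Finset ℕ) {φ : UnitAddCircle → ℝ} (hφ : Continuous φ)
    (c : ℝ) (hs : 0 < ∑ k ∈ s, (excursionWeight f α x (k : ℤ)).toReal) :
    ∫ y, φ y ∂(excursionMeasure f α x s) - c
      = (∑ k ∈ s, (excursionWeight f α x (k : ℤ)).toReal * (φ (x + k • (α : UnitAddCircle)) - c))
        / ∑ k ∈ s, (excursionWeight f α x (k : ℤ)).toReal := by
  have h1 : ∫ y, φ y ∂(∑ k ∈ s, excursionWeight f α x (k : ℤ) •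
      Measure.dirac (orbitPoint α x (k : ℤ)))
      = ∑ k ∈ s, (excursionWeight f α x (k : ℤ)).toReal * φ (x + k • (α : UnitAddCircle)) := by
    rw [integral_finsetSum_measure fun k _ =>
      (integrable_of_continuous hφ).smul_measure (excursionWeight_ne_top k)]
    refine sum_congr rfl fun k _ => ?_
    rw [integral_smul_measure, integral_dirac, orbitPoint_natCast, smul_eq_mul]
  rw [excursionMeasure, integral_smul_measure, h1, ENNReal.toReal_inv,
    ENNReal.toReal_sum fun k _ => excursionWeight_ne_top k, smul_eq_mul, eq_div_iff hs.ne', sub_mul,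
    mul_comm, ← mul_assoc, mul_inv_cancel₀ hs.ne', one_mul]
  simp only [mul_sub, sum_sub_distrib, ← sum_mul]
  ring

theorem sum_odd_range {M : Type*} [AddCommMonoid M] (F : ℕ → M) (q : ℕ) :
    ∑ k ∈ range q with Odd k, F k = ∑ j ∈ range (q / 2), F (2 * j + 1) := by
  symm
  refine sum_bij (fun j _ => 2 * j + 1) (fun j hj => ?_) (fun _ _ _ _ h => by omega)
    (fun k hk => ?_) fun _ _ => rfl
  · rw [mem_range] at hj
    exact mem_filter.2 ⟨mem_range.2 (by omega), ⟨j, rfl⟩⟩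
  · obtain ⟨h1, j, rfl⟩ := mem_filter.1 hk
    rw [mem_range] at h1
    exact ⟨j, mem_range.2 (by omega), rfl⟩

theorem sum_even_range {M : Type*} [AddCommMonoid M] (F : ℕ → M) (q : ℕ) :
    ∑ k ∈ range q with Even k, F k = ∑ j ∈ range ((q + 1) / 2), F (2 * j) := by
  symm
  refine sum_bij (fun j _ => 2 * j) (fun j hj => ?_) (fun _ _ _ _ h => by omega)
    (fun k hk => ?_) fun _ _ => rfl
  · rw [mem_range] at hj
    exact mem_filter.2 ⟨mem_range.2 (by omega), even_two_mul j⟩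
  · obtain ⟨h1, h2⟩ := mem_filter.1 hk
    obtain ⟨j, rfl⟩ := h2.two_dvd
    rw [mem_range] at h1
    exact ⟨j, mem_range.2 (by omega), rfl⟩

/-- The quotient `ψ / q`. -/
def divLeft (f ψ : C(UnitAddCircle, ℝ)) : C(UnitAddCircle, ℝ) :=
  ⟨fun x => ψ x / jumpLeft f x,
    ψ.continuous.div (continuous_jumpLeft f) fun x => (jumpLeft_pos f x).ne'⟩

theorem divLeft_apply (ψ : C(UnitAddCircle, ℝ)) (y : UnitAddCircle) :
    divLeft f ψ y = ψ y / jumpLeft f y := rfl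

theorem sum_reversibleWeight_even (n : ℕ) (ψ : C(UnitAddCircle, ℝ)) :
    ∑ j ∈ range n, reversibleWeight f α x (2 * j) * ψ (x + (2 * j) • (α : UnitAddCircle))
      = jumpLeft f x * orbitSum (2 • (α : UnitAddCircle)) (doubleSum (α : UnitAddCircle) f) n
          (divLeft f ψ) x := by
  rw [orbitSum_apply, mul_sum]
  refine sum_congr rfl fun j _ => ?_
  rw [rotationSum_doubleSum, reversibleWeight, divLeft_apply, ← mul_smul, mul_comm j 2]
  ring

/-- The first step contributes the factor `exp(f x)` and moves the base point to `x + α`; the rest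
proceeds in double steps. -/
theorem sum_reversibleWeight_odd (n : ℕ) (ψ : C(UnitAddCircle, ℝ)) :
    ∑ j ∈ range n, reversibleWeight f α x (2 * j + 1)
        * ψ (x + (2 * j + 1) • (α : UnitAddCircle))
      = jumpLeft f x * Real.exp (f x) *
        orbitSum (2 • (α : UnitAddCircle)) (doubleSum (α : UnitAddCircle) f) n
          (divLeft f ψ) (x + (α : UnitAddCircle)) := by
  rw [orbitSum_apply, mul_sum]
  refine sum_congr rfl fun j _ => ?_
  rw [rotationSum_doubleSum, reversibleWeight, divLeft_apply, ← mul_smul, mul_comm j 2,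
    rotationSum_succ', Real.exp_add, add_assoc x, ← succ_nsmul']
  ring

theorem le_divLeft_one (y : UnitAddCircle) : 1 ≤ divLeft f 1 y := by
  rw [divLeft_apply, ContinuousMap.one_apply, le_div_iff₀ (jumpLeft_pos f y), one_mul]
  linarith [jumpRight_add_jumpLeft f y, jumpRight_nonneg f y]

theorem orbitSum_one_le_divLeft (b : UnitAddCircle) (g : C(UnitAddCircle, ℝ)) (n : ℕ)
    (y : UnitAddCircle) : orbitSum b g n 1 y ≤ orbitSum b g n (divLeft f 1) y := by
  rw [orbitSum_apply, orbitSum_apply]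
  exact sum_le_sum fun j _ => mul_le_mul_of_nonneg_left (le_divLeft_one _) (Real.exp_pos _).le

end Excursion

theorem VarMajorant.frequently_oscBound {f : C(UnitAddCircle, ℝ)} {v : ℝ → ℝ} {V : ℝ}
    (hf : VarMajorant f v V) {β : ℝ} (hβ : Irrational β) :
    ∃ᶠ q in atTop, IsReturnTime (β : UnitAddCircle) q ∧ OscBound (β : UnitAddCircle) f q (6 * V) :=
  (frequently_isReturnTime hβ).mono fun _ hq => ⟨hq, hq.osc f v V hf⟩

/-! ### Comparison of excursion integrals with weighted orbit averages, and the limit -/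

section Main

variable {f : C(UnitAddCircle, ℝ)} {α : ℝ} {μ : Measure UnitAddCircle} {D : ℝ}

theorem abs_integral_oddMeasure_sub_le
    (hD : ∃ᶠ q in atTop, ∀ x, |rotationSum (α : UnitAddCircle) f q x| ≤ D)
    (φ : C(UnitAddCircle, ℝ)) (c : ℝ) {ε : ℝ} {q : ℕ} (hq : 2 ≤ q)
    (h : ∀ x, |orbitSum (2 • (α : UnitAddCircle)) (doubleSum (α : UnitAddCircle) f) (q / 2)
        (divLeft f (φ - c • 1)) x|
      ≤ ε * orbitSum (2 • (α : UnitAddCircle)) (doubleSum (α : UnitAddCircle) f) (q / 2)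
        (divLeft f 1) x) (x : UnitAddCircle) :
    |∫ y, φ y ∂(oddMeasure f α x q) - c| ≤ ε := by
  set a := (α : UnitAddCircle) with ha
  set Λ := orbitSum (2 • a) (doubleSum a f) (q / 2)
  set K := jumpLeft f x * Real.exp (f x) with hK
  have hK0 : 0 < K := mul_pos (jumpLeft_pos f x) (Real.exp_pos _)
  have hnum : ∀ ψ : C(UnitAddCircle, ℝ), ∑ k ∈ range q with Odd k,
      (excursionWeight f α x (k : ℤ)).toReal * ψ (x + k • a) = K * Λ (divLeft f ψ) (x + a) := by
    intro ψ
    rw [sum_odd_range, hK, ← sum_reversibleWeight_odd]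
    exact sum_congr rfl fun j _ => by rw [toReal_excursionWeight hD]
  have hden : ∑ k ∈ range q with Odd k, (excursionWeight f α x (k : ℤ)).toReal
      = K * Λ (divLeft f 1) (x + a) := by
    rw [← hnum 1]
    simp
  have hW : 0 < Λ (divLeft f 1) (x + a) :=
    (orbitSum_one_pos (by omega) _).trans_le (orbitSum_one_le_divLeft _ _ _ _)
  have hpos : 0 < K * Λ (divLeft f 1) (x + a) := mul_pos hK0 hW
  rw [oddMeasure, integral_excursionMeasure_sub _ φ.continuous c (by rw [hden]; exact hpos), hden]
  have h1 := hnum (φ - c • 1)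
  simp only [ContinuousMap.sub_apply, ContinuousMap.smul_apply, ContinuousMap.one_apply,
    smul_eq_mul, mul_one] at h1
  rw [h1, abs_div, abs_of_pos hpos, div_le_iff₀ hpos, abs_mul, abs_of_pos hK0]
  have := mul_le_mul_of_nonneg_left (h (x + a)) hK0.le
  linarith

/-- The visits to `0` number `w ≤ 1` instead of the reversible weight `1`. The assumption `hlarge`
makes the total mass large enough to absorb this correction, at the price of the factor `4`. -/
theorem abs_integral_evenMeasure_sub_le
    (hD : ∃ᶠ q in atTop, ∀ x, |rotationSum (α : UnitAddCircle) f q x| ≤ D)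
    (φ : C(UnitAddCircle, ℝ)) (c : ℝ) {ε : ℝ} (hε : 0 < ε) {q : ℕ} (hq : 1 ≤ q) (x : UnitAddCircle)
    (h : |orbitSum (2 • (α : UnitAddCircle)) (doubleSum (α : UnitAddCircle) f) ((q + 1) / 2)
        (divLeft f (φ - c • 1)) x|
      ≤ ε * orbitSum (2 • (α : UnitAddCircle)) (doubleSum (α : UnitAddCircle) f) ((q + 1) / 2)
        (divLeft f 1) x)
    (hlarge : ‖φ - c • 1‖ / ε + 2
      ≤ jumpLeft f x * orbitSum (2 • (α : UnitAddCircle)) (doubleSum (α : UnitAddCircle) f)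
        ((q + 1) / 2) (divLeft f 1) x) :
    |∫ y, φ y ∂(evenMeasure f α x q) - c| ≤ 4 * ε := by
  set a := (α : UnitAddCircle) with ha
  set Λ := orbitSum (2 • a) (doubleSum a f) ((q + 1) / 2)
  set K := jumpLeft f x with hK
  have hK0 : 0 < K := jumpLeft_pos f x
  set w := (excursionWeight f α x ((0 : ℕ) : ℤ)).toReal with hw
  have hw0 : 0 ≤ w := ENNReal.toReal_nonneg
  have hw1 : w ≤ 1 := ENNReal.toReal_le_of_le_ofReal zero_le_one (by
    rw [ENNReal.ofReal_one]; exact excursionWeight_zero_le)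
  have hnum : ∀ ψ : C(UnitAddCircle, ℝ), ∑ k ∈ range q with Even k,
      (excursionWeight f α x (k : ℤ)).toReal * ψ (x + k • a)
        = K * Λ (divLeft f ψ) x + (w - 1) * ψ x := by
    intro ψ
    rw [sum_even_range, hK, ← sum_reversibleWeight_even]
    obtain ⟨m, hm⟩ : ∃ m, (q + 1) / 2 = m + 1 := ⟨(q + 1) / 2 - 1, by omega⟩
    rw [hm, sum_range_succ', sum_range_succ']
    have h1 : ∀ j ∈ range m, (excursionWeight f α x ((2 * (j + 1) : ℕ) : ℤ)).toReal
        * ψ (x + (2 * (j + 1)) • a)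
        = reversibleWeight f α x (2 * (j + 1)) * ψ (x + (2 * (j + 1)) • a) := by
      intro j _
      have := toReal_excursionWeight (x := x) hD (2 * j + 1)
      rw [show 2 * (j + 1) = 2 * j + 1 + 1 by ring, this]
    rw [sum_congr rfl h1, mul_zero, reversibleWeight_zero, zero_smul, add_zero, ← hw]
    ring
  have hden : ∑ k ∈ range q with Even k, (excursionWeight f α x (k : ℤ)).toReal
      = K * Λ (divLeft f 1) x + (w - 1) := by
    have := hnum 1
    simpa using this
  set W := K * Λ (divLeft f 1) x with hW
  have hN0 := norm_nonneg (φ - c • 1)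
  have hW2 : 2 ≤ W := by
    have : 0 ≤ ‖φ - c • 1‖ / ε := by positivity
    linarith
  have hWN : ‖φ - c • 1‖ + 2 * ε ≤ ε * W := by
    have := mul_le_mul_of_nonneg_left hlarge hε.le
    rwa [mul_add, mul_div_cancel₀ _ hε.ne', mul_comm ε 2] at this
  have hpos : 0 < W + (w - 1) := by linarith
  rw [evenMeasure, integral_excursionMeasure_sub _ φ.continuous c (by rw [hden]; exact hpos), hden]
  have h1 := hnum (φ - c • 1)
  have h2 : ∀ y, (φ - c • 1 : C(UnitAddCircle, ℝ)) y = φ y - c := fun y => by simp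
  simp only [h2] at h1
  rw [h1, abs_div, abs_of_pos hpos, div_le_iff₀ hpos, ← h2]
  have h3 : |K * Λ (divLeft f (φ - c • 1)) x| ≤ ε * W := by
    rw [abs_mul, abs_of_pos hK0, hW]
    have := mul_le_mul_of_nonneg_left h hK0.le
    linarith
  have h4 : |(w - 1) * (φ - c • 1 : C(UnitAddCircle, ℝ)) x| ≤ ‖φ - c • 1‖ := by
    rw [abs_mul]
    have h5 : |w - 1| ≤ 1 := by rw [abs_le]; constructor <;> linarith
    have h6 := (φ - c • 1).norm_coe_le_norm x
    calc _ ≤ 1 * ‖φ - c • 1‖ := mul_le_mul h5 h6 (abs_nonneg _) zero_le_one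
      _ = _ := one_mul _
  have h5 := abs_add_le (K * Λ (divLeft f (φ - c • 1)) x)
    ((w - 1) * (φ - c • 1 : C(UnitAddCircle, ℝ)) x)
  nlinarith

theorem two_smul_coe (α : ℝ) : 2 • (α : UnitAddCircle) = ((2 * α : ℝ) : UnitAddCircle) := by
  rw [← AddCircle.coe_nsmul, nsmul_eq_mul, Nat.cast_ofNat]

theorem inv_le_jumpLeft (f : C(UnitAddCircle, ℝ)) (x : UnitAddCircle) :
    1 / (1 + Real.exp ‖f‖) ≤ jumpLeft f x := by
  rw [jumpLeft_eq]
  have := (le_abs_self (f x)).trans (f.norm_coe_le_norm x)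
  gcongr

theorem exists_forall_abs_integral_sub_le (hα : Irrational α) (hsymm : IsSymmetric f)
    (hbv : HasBoundedVariation f) (hμ : IsStationary f α μ) (φ : C(UnitAddCircle, ℝ)) {ε : ℝ}
    (hε : 0 < ε) : ∃ q₀ : ℕ, ∀ q, q₀ ≤ q → ∀ x,
      |∫ y, φ y ∂(oddMeasure f α x q) - ∫ y, φ y ∂μ| ≤ ε ∧
      |∫ y, φ y ∂(evenMeasure f α x q) - ∫ y, φ y ∂μ| ≤ ε := by
  have := hμ.1
  set a := (α : UnitAddCircle) with ha
  set g := doubleSum a f with hg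
  obtain ⟨v, V, hv⟩ := hbv.exists_varMajorant
  have hB := VarMajorant.frequently_oscBound hv hα
  have hD := frequently_abs_rotationSum_le hB hsymm
  have hv2 : VarMajorant g _ _ := hv.add (hv.comp_add α)
  have hα2 : Irrational (2 * α) := by
    exact_mod_cast hα.natCast_mul (two_ne_zero)
  have hB2 := VarMajorant.frequently_oscBound hv2 hα2
  rw [← two_smul_coe] at hB2
  have hmean2 : ∫ x, g x = 0 := by
    have h1 : ∀ x, g x = rotationSum a f 2 x := fun x => by
      have := rotationSum_doubleSum (f := f) a 1 x
      simpa [rotationSum] using this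
    rw [integral_congr_ae (ae_of_all _ h1), integral_rotationSum f.continuous, hsymm, mul_zero]
  have hD2 := frequently_abs_rotationSum_le hB2 hmean2
  obtain ⟨hl, hconf⟩ := hμ.isConformal hB hsymm
  set c := ∫ y, φ y ∂μ with hc
  -- The density `q` cancels the division by `q`, leaving the integral of the centred function `φ -
  -- c` against `μ`.
  have hzero : ((leftFunctional f μ 1)⁻¹ • leftFunctional f μ) (divLeft f (φ - c • 1)) = 0 := by
    rw [LinearMap.smul_apply, leftFunctional_apply (divLeft f _)]
    have h1 : ∀ y, jumpLeft f y * divLeft f (φ - c • 1) y = φ y - c := fun y => by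
      rw [divLeft_apply, mul_div_cancel₀ _ (jumpLeft_pos f y).ne']
      simp
    rw [integral_congr_ae (ae_of_all _ h1), integral_sub (integrable_of_continuous φ.continuous) (integrable_const _), ← hc]
    simp
  have hε4 : 0 < ε / 4 := by positivity
  have hconv := hconf.eventually_abs_sub_lt hB2 hmean2 (divLeft f (φ - c • 1)) hε4
  rw [hzero] at hconv
  -- The second factor offsets the lower bound `1 / (1 + exp ‖f‖)` for `jumpLeft`.
  set R := (‖φ - c • 1‖ / (ε / 4) + 2) * (1 + Real.exp ‖f‖) with hR
  obtain ⟨N, hN⟩ := eventually_atTop.1 (hconv.and (eventually_le_orbitSum_one hD2 R))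
  have key : ∀ n, N ≤ n → 0 < n → ∀ x, |orbitSum (2 • a) g n (divLeft f (φ - c • 1)) x|
      ≤ ε / 4 * orbitSum (2 • a) g n (divLeft f 1) x := by
    intro n hn hn0 x
    have h1 := (hN n hn).1 x
    have hW := orbitSum_one_pos (b := 2 • a) (g := g) hn0 x
    rw [sub_zero, abs_div, abs_of_pos hW, div_lt_iff₀ hW] at h1
    refine h1.le.trans ?_
    gcongr
    exact orbitSum_one_le_divLeft _ _ _ _
  refine ⟨2 * N + 2, fun q hq x => ⟨?_, ?_⟩⟩
  · refine (abs_integral_oddMeasure_sub_le hD φ c (by omega)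
      (key (q / 2) (by omega) (by omega)) x).trans (by linarith)
  · refine (abs_integral_evenMeasure_sub_le hD φ c hε4 (by omega) x
      (key ((q + 1) / 2) (by omega) (by omega) x) ?_).trans (by linarith)
    have h1 := ((hN ((q + 1) / 2) (by omega)).2 x).1
    have h2 := h1.trans (orbitSum_one_le_divLeft (f := f) _ _ _ _)
    have hE : 0 < 1 + Real.exp ‖f‖ := by positivity
    have hN0 := norm_nonneg (φ - c • 1)
    calc ‖φ - c • 1‖ / (ε / 4) + 2 = 1 / (1 + Real.exp ‖f‖) * R := by rw [hR]; field_simp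
      _ ≤ _ := mul_le_mul (inv_le_jumpLeft f x) h2 (by positivity) (jumpLeft_nonneg f x)

end Main

end

end QuasiPeriodicWalk

theorem proposition1 (α : ℝ) (hα : Irrational α) (f : C(UnitAddCircle, ℝ))
    (hsymm : QuasiPeriodicWalk.IsSymmetric f)
    (hbv : QuasiPeriodicWalk.HasBoundedVariation f)
    (μ : Measure UnitAddCircle) (hμ : QuasiPeriodicWalk.IsStationary f α μ)
    (φ : C(UnitAddCircle, ℝ)) (ε : ℝ) (hε : 0 < ε) :
    ∃ q₀ : ℕ, ∀ q : ℕ, q₀ ≤ q → QuasiPeriodicWalk.IsCloseReturnTime α q →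
      (⨆ x : UnitAddCircle, ENNReal.ofReal
          |∫ y, φ y ∂(QuasiPeriodicWalk.oddMeasure f α x q) - ∫ y, φ y ∂μ|) <
        ENNReal.ofReal ε ∧
      (⨆ x : UnitAddCircle, ENNReal.ofReal
          |∫ y, φ y ∂(QuasiPeriodicWalk.evenMeasure f α x q) - ∫ y, φ y ∂μ|) <
        ENNReal.ofReal ε := by
  -- Halving `ε` keeps the inequality strict after taking the supremum over `x`.
  obtain ⟨q₀, h⟩ := QuasiPeriodicWalk.exists_forall_abs_integral_sub_le hα hsymm hbv hμ φ
    (half_pos hε)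
  have hlt : ENNReal.ofReal (ε / 2) < ENNReal.ofReal ε :=
    (ENNReal.ofReal_lt_ofReal_iff hε).2 (half_lt_self hε)
  exact ⟨q₀, fun q hq _ =>
    ⟨(iSup_le fun x => ENNReal.ofReal_le_ofReal (h q hq x).1).trans_lt hlt,
      (iSup_le fun x => ENNReal.ofReal_le_ofReal (h q hq x).2).trans_lt hlt⟩⟩
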